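/- **Setting.** A *semigroupoid* is a set $G$ with a partially defined multiplication, where $e\in G$ is called *idempotent* if $ex=x$ whenever $ex$ is defined and $ye=y$ whenever $ye$ is defined, such that: (1) if one of $(ab)c$, $a(bc)$ is defined, so is the other and they are equal, and if $ab$ and $bc$ are defined then so is $(ab)c$; (2) for each $a$ there are $e,f$ with $ea=a=af$, and $e^2=e$ implies that $e$ is idempotent; (3) if $ab=e$ with $e$ idempotent, then $a=b=e$; (4) for each $a$ the set $\{(z,b,w): zbw=a\}$ is finite, and $\sup_{a,c}\operatorname{card}\{b: cb=a\}<\infty$. Write $b\le a$ if $a=zbw$ for some $z,w$; a set $F\subset G$ is *lower* if $a\in F$, $b\le a$ imply $b\in F$. Put $(f\star g)(a)=\sum_{rs=a}f(r)g(s)$ for functions, with unit $\delta$ (equal to $1$ at idempotents and $0$ elsewhere), and for kernels put $(A\star B)(a,b)=\sum_{pq=a}\sum_{rs=b}A(p,r)B(q,s)$ and $(A\,\hat\star\,B)(a,b)=\sum_{pq=a}\sum_{rs=b}A(q,s)B(p,r)$; $[1](a,b)$ is $1$ if $a,b$ are both idempotent and $0$ otherwise, and $(ff^*)(x,y)=f(x)f(y)^*$.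 A *collection of test functions* is a nonempty set $\Psi$ of functions $\psi:G\to\mathbb C$ such that (a) for each finite lower set $F$ and $\psi\in\Psi$, the matrix $\mathfrak T(\psi)=\big(\sum_{c:\,cb=a}\psi(c)\big)_{a,b\in F}$ has norm at most $1$ on $\ell^2(F)$; (b) for each idempotent $a$, the $n$-fold $\star$-powers satisfy $\psi^{n_\star}(a)=\psi(a)^n\to0$ uniformly in $\psi\in\Psi$; (c) for each finite lower set $F$, the restrictions $\psi|_F$, $\psi\in\Psi$, generate the unital algebra of all functions on $F$ with the product $\star$. Let $\mathcal K_\Psi$ be the set of positive semidefinite kernels $k:G\times G\to\mathbb C$ such that $([1]-\psi\psi^*)\star k$ is positive semidefinite for every $\psi\in\Psi$. Let $H^\infty(\mathcal K_\Psi)$ be the set of $\varphi:G\to\mathbb C$ for which there is a $C>0$ such that $(C^2[1]-\varphi\varphi^*)\star k$ is positive semidefinite for every $k\in\mathcal K_\Psi$; $\|\varphi\|$ is the infimum of all such $C$. Let $\mathfrak B=C_b(\Psi)$ be the $C^*$-algebra of bounded continuous functions on $\Psi$, where $\Psi$ has the topology of pointwise convergence ($\mathfrak B=C(\Psi)$ if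 $\Psi$ is compact), $\mathfrak B^*$ its Banach space dual, and $E:G\to\mathfrak B$, $E(x)(\psi)=\psi(x)$. A kernel $\Gamma:X\times X\to\mathfrak B^*$ is *positive* if $\sum_{x,y\in A}\Gamma(x,y)(f(x)f(y)^*)\ge0$ for every finite $A\subset X$ and $f:A\to\mathfrak B$; in $\Gamma\,\hat\star\,M$ with a $\mathfrak B$-valued kernel $M$, functionals are evaluated at the entries of $M$. A *$\mathfrak B$-unitary colligation* is a triple $\Sigma=(U,\mathcal E,\rho)$ of a Hilbert space $\mathcal E$, a unitary $U=\begin{pmatrix}A&B\\C&D\end{pmatrix}$ on $\mathcal E\oplus\mathbb C$ and a unital $*$-representation $\rho:\mathfrak B\to B(\mathcal E)$; its transfer function is $$W_\Sigma(x)=D\delta(x)+C\big(\rho(E)\star(\delta-A\rho(E))^{-1_\star}\star(B\delta)\big)(x),$$ where $^{-1_\star}$ is the inverse with respect to $\star$. **Theorem (Realization).** Let $\Psi$ be a collection of test functions on a semigroupoid $G$ and let $\varphi:G\to\mathbb C$. The following are equivalent: (i) $\varphi\in H^\infty(\mathcal K_\Psi)$ and $\|\varphi\|_{H^\infty(\mathcal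 K_\Psi)}\le1$; (iiF) for each finite lower set $F\subset G$ there is a positive kernel $\Gamma:F\times F\to\mathfrak B^*$ with $([1]-\varphi\varphi^*)(x,y)=(\Gamma\,\hat\star\,([1]-EE^*))(x,y)$ for all $x,y\in F$; (iiG) there is a positive kernel $\Gamma:G\times G\to\mathfrak B^*$ with $([1]-\varphi\varphi^*)(x,y)=(\Gamma\,\hat\star\,([1]-EE^*))(x,y)$ for all $x,y\in G$; (iii) there is a $\mathfrak B$-unitary colligation $\Sigma$ with $\varphi=W_\Sigma$. -/

import Mathlib

open scoped ComplexOrder BoundedContinuousFunction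

universe u

/-! ## Semigroupoids -/

/-- A partial multiplication on `G`: `pmul a b = some c` means that `ab` is defined and equals `c`;
`pmul a b = none` means that `ab` is not defined. -/
class PartialMul (G : Type u) where
  pmul : G → G → Option G

section Semigroupoids

open PartialMul

/-- `e` is idempotent: `ex = x` whenever `ex` is defined, and `ye = y` whenever `ye` is defined. -/
def IsIdem {G : Type u} [PartialMul G] (e : G) : Prop :=
  (∀ x z, pmul e x = some z → z = x) ∧ (∀ y z, pmul y e = some z → z = y)

/-- The product `(zb)w`, where defined. -/
def pmul₃ {G : Type u} [PartialMul G] (z b w : G) : Option G :=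
  (pmul z b).bind fun m => pmul m w

/-- A semigroupoid: the associative law, the existence of idempotents, the nonexistence of
inverses and the strong artinian law. -/
class Semigroupoid (G : Type u) extends PartialMul G where
  assoc : ∀ a b c : G, pmul₃ a b c = (pmul b c).bind fun m => pmul a m
  assoc_defined : ∀ a b c : G, (pmul a b).isSome → (pmul b c).isSome → (pmul₃ a b c).isSome
  exists_idem : ∀ a : G, ∃ e f : G, pmul e a = some a ∧ pmul a f = some a
  idem_of_sq : ∀ e : G, pmul e e = some e → IsIdem e
  no_inverses : ∀ a b e : G, IsIdem e → pmul a b = some e → a = e ∧ b = e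
  artinian : ∀ a : G, {t : G × G × G | pmul₃ t.1 t.2.1 t.2.2 = some a}.Finite
  artinian_bound : ∃ N : ℕ, ∀ a c : G, {b : G | pmul c b = some a}.encard ≤ N

/-- The order of a semigroupoid: `b ≤ a` iff `a = zbw` for some `z`, `w`. -/
def Precedes {G : Type u} [PartialMul G] (b a : G) : Prop :=
  ∃ z w : G, pmul₃ z b w = some a

/-- Lower sets. -/
def IsLower {G : Type u} [PartialMul G] (F : Set G) : Prop :=
  ∀ a ∈ F, ∀ b, Precedes b a → b ∈ F

theorem finite_pairs {G : Type u} [Semigroupoid G] (a : G) :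
    {p : G × G | pmul p.1 p.2 = some a}.Finite := by
  obtain ⟨e, f, he, hf⟩ := Semigroupoid.exists_idem a
  refine Set.Finite.of_finite_image (f := fun p : G × G => (p.1, p.2, f))
    ((Semigroupoid.artinian a).subset ?_) ?_
  · rintro _ ⟨p, hp, rfl⟩
    have hp' : pmul p.1 p.2 = some a := hp
    simp [pmul₃, hp', hf]
  · rintro ⟨p, q⟩ _ ⟨p', q'⟩ _ h
    simp only [Prod.mk.injEq] at h
    simp [h.1, h.2.1]

/-- The finite set of the pairs `(r, s)` with `rs = a`. -/
noncomputable def factorPairs {G : Type u} [Semigroupoid G] (a : G) : Finset (G × G) :=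
  (finite_pairs a).toFinset

@[simp] theorem mem_factorPairs {G : Type u} [Semigroupoid G] {a : G} {p : G × G} :
    p ∈ factorPairs a ↔ pmul p.1 p.2 = some a := by
  simp [factorPairs]

/-! ## Convolution products -/

/-- The product `(f ⋆ g)(a) = ∑_{rs = a} f(r) g(s)`. The values of `g` may lie in a space on which
those of `f` act: for `f`, `g` with values in the same algebra, `f(r) • g(s) = f(r) * g(s)`, and
for operators `T` and vectors `v`, `T • v = T v`. -/
noncomputable def conv {G : Type u} [Semigroupoid G] {A M : Type*} [SMul A M] [AddCommMonoid M]
    (f : G → A) (g : G → M) (a : G) : M :=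
  ∑ p ∈ factorPairs a, f p.1 • g p.2

open Classical in
/-- The unit `δ` of the `⋆`-product. -/
noncomputable def deltaFun {G : Type u} [Semigroupoid G] (A : Type*) [Zero A] [One A] (x : G) : A :=
  if IsIdem x then 1 else 0

/-- `g` is the (two-sided) `⋆`-inverse of `f`. -/
def IsStarInverse {G : Type u} [Semigroupoid G] {A : Type*} [Ring A] (f g : G → A) : Prop :=
  conv f g = deltaFun A ∧ conv g f = deltaFun A

open Classical in
/-- The `⋆`-inverse of a function. The `⋆`-product is associative with unit `δ`, so an inverse is
unique; it exists iff `f e` is invertible for every idempotent `e`. -/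
noncomputable def starInv {G : Type u} [Semigroupoid G] {A : Type*} [Ring A] (f : G → A) : G → A :=
  if h : ∃ g, IsStarInverse f g then h.choose else 0

/-- The `n`-fold `⋆`-product of `f` with itself. -/
noncomputable def starPow {G : Type u} [Semigroupoid G] (f : G → ℂ) : ℕ → G → ℂ
  | 0 => deltaFun ℂ
  | n + 1 => conv f (starPow f n)

open Classical in
/-- Extension by zero of a function on `F`. -/
noncomputable def extendZero {G : Type u} {F : Finset G} {A : Type*} [Zero A] (f : F → A) (x : G) :
    A :=
  if h : x ∈ F then f ⟨x, h⟩ else 0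

/-- Extension by zero of a function on `F × F`. -/
noncomputable def extendKernel {G : Type u} {F : Finset G} {A : Type*} [Zero A] (Γ : F → F → A)
    (x y : G) : A :=
  extendZero (extendZero Γ x) y

/-- The `⋆`-product on the space `P(F)` of functions on a lower set `F`. If `F` is lower and
`rs = a ∈ F`, then `r, s ∈ F`, so that the values of the extensions off `F` are not used. -/
noncomputable def convOn {G : Type u} [Semigroupoid G] (F : Finset G) (f g : F → ℂ) : F → ℂ :=
  fun a => conv (extendZero f) (extendZero g) a

/-- Membership in the (unital) subalgebra of `P(F)` generated by `S`. -/
inductive StarGenerated {G : Type u} [Semigroupoid G] (F : Finset G) (S : Set (F → ℂ)) :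
    (F → ℂ) → Prop
  | base (f : F → ℂ) (hf : f ∈ S) : StarGenerated F S f
  | unit : StarGenerated F S (fun x => deltaFun ℂ (x : G))
  | add (f g : F → ℂ) : StarGenerated F S f → StarGenerated F S g → StarGenerated F S (f + g)
  | smul (c : ℂ) (f : F → ℂ) : StarGenerated F S f → StarGenerated F S (c • f)
  | conv (f g : F → ℂ) : StarGenerated F S f → StarGenerated F S g →
      StarGenerated F S (convOn F f g)

/-- The matrix `⋆`-product `(A ⋆ B)(a,b) = ∑_{pq = a} ∑_{rs = b} A(p,r) B(q,s)`. -/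
noncomputable def kconv {G : Type u} [Semigroupoid G] (A B : G → G → ℂ) (a b : G) : ℂ :=
  ∑ p ∈ factorPairs a, ∑ r ∈ factorPairs b, A p.1 r.1 * B p.2 r.2

/-- The product `(Γ ⋆̂ M)(a,b) = ∑_{pq = a} ∑_{rs = b} Γ(q,s) (M(p,r))` of a kernel with values in
the dual of `𝔅` and a kernel with values in `𝔅`. -/
noncomputable def khat {G : Type u} [Semigroupoid G] {𝔅 : Type*} [NormedAddCommGroup 𝔅]
    [NormedSpace ℂ 𝔅] (Γ : G → G → StrongDual ℂ 𝔅) (M : G → G → 𝔅) (a b : G) : ℂ :=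
  ∑ p ∈ factorPairs a, ∑ r ∈ factorPairs b, Γ p.2 r.2 (M p.1 r.1)

open Classical in
/-- The matrix `[1]`. -/
noncomputable def oneMat {G : Type u} [Semigroupoid G] (A : Type*) [Zero A] [One A] (a b : G) : A :=
  if IsIdem a ∧ IsIdem b then 1 else 0

/-- The matrix `f f*`, i.e. `(f f*)(x,y) = f(x) f(y)*`. -/
def outer {G : Type u} {A : Type*} [Mul A] [Star A] (f : G → A) (x y : G) : A :=
  f x * star (f y)

/-! ## Positive kernels -/

/-- Positive (semidefinite) scalar kernels. -/
def IsPosKernel {X : Type*} (k : X → X → ℂ) : Prop :=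
  ∀ A : Finset X, (Matrix.of fun a b : A => k a b).PosSemidef

/-- Positive kernels with values in the dual of `𝔅`. -/
def IsPosDualKernel {X 𝔅 : Type*} [NormedRing 𝔅] [StarRing 𝔅] [NormedSpace ℂ 𝔅]
    (Γ : X → X → StrongDual ℂ 𝔅) : Prop :=
  ∀ (A : Finset X) (f : X → 𝔅), 0 ≤ ∑ x ∈ A, ∑ y ∈ A, Γ x y (f x * star (f y))

/-! ## Test functions -/

open Classical in
/-- The (left) Toeplitz matrix on `F`, with `(a,b)` entry `∑_{cb = a} φ(c)`. -/
noncomputable def toeplitz {G : Type u} [Semigroupoid G] (F : Finset G) (φ : G → ℂ) :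
    Matrix F F ℂ :=
  Matrix.of fun a b => ∑ p ∈ factorPairs (a : G) with p.2 = (b : G), φ p.1

open Classical in
/-- `Ψ` is a collection of test functions on `G`. -/
structure IsTestFamily {G : Type u} [Semigroupoid G] (Ψ : Set (G → ℂ)) : Prop where
  toeplitz_le : ∀ F : Finset G, IsLower (F : Set G) → ∀ ψ ∈ Ψ,
    ‖Matrix.toEuclideanCLM (n := F) (𝕜 := ℂ) (toeplitz F ψ)‖ ≤ 1
  tendsto_zero : ∀ a : G, IsIdem a →
    TendstoUniformlyOn (fun (n : ℕ) (ψ : G → ℂ) => starPow ψ n a) (fun _ => 0) Filter.atTop Ψ ∧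
    TendstoUniformlyOn (fun (n : ℕ) (ψ : G → ℂ) => ψ a ^ n) (fun _ => 0) Filter.atTop Ψ
  generates : ∀ F : Finset G, IsLower (F : Set G) →
    ∀ f : F → ℂ, StarGenerated F {g | ∃ ψ ∈ Ψ, g = fun x : F => ψ x} f

/-! ## The algebra determined by the kernels of a collection of test functions -/

/-- The collection `𝒦_Ψ` of the positive kernels `k` on `G` such that `([1] - ψψ*) ⋆ k` is positive
for every `ψ ∈ Ψ`. -/
def kernelFamily {G : Type u} [Semigroupoid G] (Ψ : Set (G → ℂ)) : Set (G → G → ℂ) :=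
  {k | IsPosKernel k ∧ ∀ ψ ∈ Ψ, IsPosKernel (kconv (oneMat ℂ - outer ψ) k)}

/-- The constants `C > 0` such that `(C²[1] - φφ*) ⋆ k` is positive for every `k ∈ 𝒦_Ψ`. -/
def hInftyBounds {G : Type u} [Semigroupoid G] (Ψ : Set (G → ℂ)) (φ : G → ℂ) : Set ℝ :=
  {C | 0 < C ∧ ∀ k ∈ kernelFamily Ψ,
    IsPosKernel (kconv (((C : ℂ) ^ 2) • oneMat ℂ - outer φ) k)}

/-- `φ ∈ H^∞(𝒦_Ψ)`. -/
def MemHInfty {G : Type u} [Semigroupoid G] (Ψ : Set (G → ℂ)) (φ : G → ℂ) : Prop :=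
  (hInftyBounds Ψ φ).Nonempty

/-- The norm of `H^∞(𝒦_Ψ)`. -/
noncomputable def hInftyNorm {G : Type u} [Semigroupoid G] (Ψ : Set (G → ℂ)) (φ : G → ℂ) : ℝ :=
  sInf (hInftyBounds Ψ φ)

/-! ## The evaluation map

To view `E(x) : ψ ↦ ψ(x)` as a bounded function on `Ψ`, one needs `|ψ(x)| ≤ 1`. -/

theorem isIdem_of_pmul_eq_self {G : Type u} [Semigroupoid G] {a f : G} (hf : pmul a f = some a) :
    IsIdem f := by
  let S := {y : G // pmul a y = some a}
  have key : ∀ y y' : S, ∃ z : S, pmul y.1 y'.1 = some z.1 := by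
    intro y y'
    have h := Semigroupoid.assoc a y.1 y'.1
    simp only [pmul₃, y.2, Option.bind_some, y'.2] at h
    rcases hz : pmul y.1 y'.1 with _ | z
    · simp [hz] at h
    · simp only [hz, Option.bind_some] at h
      exact ⟨⟨z, h.symm⟩, rfl⟩
  choose m hm using key
  have : Finite S := by
    have hfin := (finite_pairs a).preimage (f := fun y : G => (a, y))
      (fun y _ y' _ h => by simpa using h)
    exact hfin.to_subtype
  let _ : Semigroup S :=
    { mul := m
      mul_assoc := by
        intro x y z
        have h := Semigroupoid.assoc x.1 y.1 z.1
        simp only [pmul₃, hm, Option.bind_some, Option.some.injEq] at h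
        exact Subtype.ext h }
  let _ : TopologicalSpace S := ⊥
  have : DiscreteTopology S := ⟨rfl⟩
  let f' : S := ⟨f, hf⟩
  obtain ⟨e, ⟨y, rfl⟩, he⟩ := exists_idempotent_in_compact_subsemigroup (M := S)
    (fun _ => continuous_of_discreteTopology) (Set.range fun y => f' * y) ⟨f' * f', f', rfl⟩
    (Set.toFinite _).isCompact
    (by rintro _ ⟨x, rfl⟩ _ ⟨y, rfl⟩; exact ⟨x * (f' * y), by simp only [mul_assoc]⟩)
  have hidem : IsIdem (f' * y).1 := by
    apply Semigroupoid.idem_of_sq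
    rw [hm]
    exact congrArg (fun s : S => some s.1) he
  have h := (Semigroupoid.no_inverses f y.1 _ hidem (hm f' y)).1
  rw [h]
  exact hidem

theorem precedes_trans {G : Type u} [Semigroupoid G] {a b c : G} (h₁ : Precedes c b)
    (h₂ : Precedes b a) : Precedes c a := by
  obtain ⟨z, w, h₁⟩ := h₁
  obtain ⟨z', w', h₂⟩ := h₂
  simp only [pmul₃, Option.bind_eq_some_iff] at h₁ h₂
  obtain ⟨m, hm, hb⟩ := h₁
  obtain ⟨m', hm', ha⟩ := h₂
  have e₁ := Semigroupoid.assoc z' m w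
  simp only [pmul₃, hb, Option.bind_some, hm'] at e₁
  obtain ⟨n, hn, hn'⟩ := Option.bind_eq_some_iff.1 e₁
  have e₂ := Semigroupoid.assoc z' z c
  simp only [pmul₃, hm, Option.bind_some, hn] at e₂
  obtain ⟨s, hs, hs'⟩ := Option.bind_eq_some_iff.1 e₂
  have e₃ := Semigroupoid.assoc n w w'
  simp only [pmul₃, hn', Option.bind_some, ha] at e₃
  obtain ⟨t, ht, ht'⟩ := Option.bind_eq_some_iff.1 e₃.symm
  exact ⟨s, t, by simp [pmul₃, hs', ht']⟩

theorem finite_precedes {G : Type u} [Semigroupoid G] (a : G) : {b : G | Precedes b a}.Finite := by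
  refine ((Semigroupoid.artinian a).image fun t => t.2.1).subset ?_
  rintro b ⟨z, w, h⟩
  exact ⟨(z, b, w), h, rfl⟩

theorem precedes_refl {G : Type u} [Semigroupoid G] (a : G) : Precedes a a := by
  obtain ⟨e, f, he, hf⟩ := Semigroupoid.exists_idem a
  exact ⟨e, f, by simp [pmul₃, he, hf]⟩

theorem precedes_of_pmul {G : Type u} [Semigroupoid G] {a f : G} (hf : pmul a f = some a) :
    Precedes f a := by
  obtain ⟨e, g, he, hg⟩ := Semigroupoid.exists_idem a
  exact ⟨a, g, by simp [pmul₃, hf, hg]⟩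

theorem IsTestFamily.norm_apply_le {G : Type u} [Semigroupoid G] {Ψ : Set (G → ℂ)}
    (hΨ : IsTestFamily Ψ) (ψ : G → ℂ) (hψ : ψ ∈ Ψ) (x : G) : ‖ψ x‖ ≤ 1 := by
  classical
  obtain ⟨e, f, he, hf⟩ := Semigroupoid.exists_idem x
  let F : Finset G := (finite_precedes x).toFinset
  have hF : IsLower (F : Set G) := by
    intro a ha b hb
    have ha' : Precedes a x := by simpa [F] using ha
    simpa [F] using precedes_trans hb ha'
  have hx : x ∈ F := by simpa [F] using precedes_refl x
  have hfF : f ∈ F := by simpa [F] using precedes_of_pmul hf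
  have hidem := isIdem_of_pmul_eq_self hf
  have hentry : toeplitz F ψ ⟨x, hx⟩ ⟨f, hfF⟩ = ψ x := by
    have : (factorPairs x).filter (fun p => p.2 = f) = {(x, f)} := by
      ext ⟨p, q⟩
      simp only [Finset.mem_filter, mem_factorPairs, Finset.mem_singleton, Prod.mk.injEq]
      constructor
      · rintro ⟨h, rfl⟩
        exact ⟨(hidem.2 p x h).symm, rfl⟩
      · rintro ⟨rfl, rfl⟩
        exact ⟨hf, rfl⟩
    simp [toeplitz, this]
  have hn := hΨ.toeplitz_le F hF ψ hψ
  set T := Matrix.toEuclideanCLM (n := F) (𝕜 := ℂ) (toeplitz F ψ) with hT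
  let v : EuclideanSpace ℂ F := EuclideanSpace.single ⟨f, hfF⟩ 1
  have hv : (T v) ⟨x, hx⟩ = ψ x := by
    rw [← hentry, hT]
    simp [v, Matrix.ofLp_toEuclideanCLM]
  calc ‖ψ x‖ = ‖(T v) ⟨x, hx⟩‖ := by rw [hv]
    _ ≤ ‖T v‖ := PiLp.norm_apply_le _ _
    _ ≤ ‖T‖ * ‖v‖ := T.le_opNorm v
    _ ≤ 1 := by simpa [v] using hn

/-- The evaluation map `E : G → C_b(Ψ)`, `E(x)(ψ) = ψ(x)`. Here `Ψ` carries the topology of pointwise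
convergence; if `Ψ` is compact, then `C_b(Ψ)` consists of all continuous functions on `Ψ`. -/
noncomputable def evalMap {G : Type u} [Semigroupoid G] {Ψ : Set (G → ℂ)} (hΨ : IsTestFamily Ψ)
    (x : G) : Ψ →ᵇ ℂ :=
  BoundedContinuousFunction.ofNormedAddCommGroup (fun ψ : Ψ => (ψ : G → ℂ) x)
    ((continuous_apply x).comp continuous_subtype_val) 1
    fun ψ => hΨ.norm_apply_le ψ.1 ψ.2 x

end Semigroupoids

/-! ## Colligations and transfer functions -/

/-- A `𝔅`-unitary colligation: a Hilbert space `ℰ`, a unitary operator `U` of the Hilbert space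
`ℰ ⊕ ℂ` and a unital `*`-representation `ρ` of `𝔅` on `ℰ`. -/
structure UnitaryColligation (𝔅 : Type u) [Ring 𝔅] [Algebra ℂ 𝔅] [Star 𝔅] where
  ℰ : Type u
  [normedAddCommGroup : NormedAddCommGroup ℰ]
  [innerProductSpace : InnerProductSpace ℂ ℰ]
  [completeSpace : CompleteSpace ℰ]
  U : WithLp 2 (ℰ × ℂ) ≃ₗᵢ[ℂ] WithLp 2 (ℰ × ℂ)
  ρ : 𝔅 →⋆ₐ[ℂ] (ℰ →L[ℂ] ℰ)

namespace UnitaryColligation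

attribute [instance] normedAddCommGroup innerProductSpace completeSpace

variable {𝔅 : Type u} [Ring 𝔅] [Algebra ℂ 𝔅] [Star 𝔅] (S : UnitaryColligation 𝔅)

/-- The operator `U`, on the product `ℰ × ℂ`. -/
noncomputable def prodU : S.ℰ × ℂ →L[ℂ] S.ℰ × ℂ :=
  (WithLp.prodContinuousLinearEquiv 2 ℂ S.ℰ ℂ : WithLp 2 (S.ℰ × ℂ) →L[ℂ] S.ℰ × ℂ) ∘L
    (S.U.toContinuousLinearEquiv : WithLp 2 (S.ℰ × ℂ) →L[ℂ] WithLp 2 (S.ℰ × ℂ)) ∘L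
    ((WithLp.prodContinuousLinearEquiv 2 ℂ S.ℰ ℂ).symm : S.ℰ × ℂ →L[ℂ] WithLp 2 (S.ℰ × ℂ))

/-- The block `A` of `U`. -/
noncomputable def A : S.ℰ →L[ℂ] S.ℰ :=
  ContinuousLinearMap.fst ℂ S.ℰ ℂ ∘L S.prodU ∘L ContinuousLinearMap.inl ℂ S.ℰ ℂ

/-- The block `B` of `U`, an operator `ℂ → ℰ`, given as the image of `1` under it. -/
noncomputable def B : S.ℰ := (S.prodU (0, 1)).1

/-- The block `C` of `U`. -/
noncomputable def C : S.ℰ →L[ℂ] ℂ :=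
  ContinuousLinearMap.snd ℂ S.ℰ ℂ ∘L S.prodU ∘L ContinuousLinearMap.inl ℂ S.ℰ ℂ

/-- The block `D` of `U`, an operator on `ℂ`, given as a number. -/
noncomputable def D : ℂ := (S.prodU (0, 1)).2

/-- The transfer function `W = Dδ + C (ρ(E) ⋆ (δ - Aρ(E))^{-1} ⋆ (Bδ))`, with the inverse taken with
respect to `⋆`. -/
noncomputable def transfer {G : Type u} [Semigroupoid G] (E : G → 𝔅) (x : G) : ℂ :=
  S.D * deltaFun ℂ x +
    S.C (conv
      (conv (fun y => S.ρ (E y))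
        (starInv (fun y => deltaFun (S.ℰ →L[ℂ] S.ℰ) y - S.A * S.ρ (E y))))
      (fun y => deltaFun ℂ y • S.B) x)

end UnitaryColligation

/-! ## Idempotents and the order given by left factors -/

section Order

open PartialMul

variable {G : Type u} [Semigroupoid G]

/-! The implications form the cycle (i) → (iiF) → (iiG) → (iii) → (i). Triangularity underlies all
of them: in a factorization `x = pq`, either `p` is idempotent and `q = x`, or `q` lies strictly
below `x` in the well-founded order `LeftLt`. Convolution equations are thus solved recursively,
with only the values at idempotents to invert, and there `‖E e‖ < 1`.

(i) → (iiF) is a cone separation argument (`exists_separating_weight`). On a finite lower set `F`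
the matrices `Γ ⋆̂ ([1] - EE*)` form a closed convex cone. Were `[1] - φφ*` outside it, a separating
functional would give a Hermitian form `Λ` on `ℂ^F`. Rank one kernels supported at a test function
show `T*ΛT ≤ Λ` for its Toeplitz matrix `T`, and `Tⁿ → 0` then forces `Λ ≥ 0`. The inverse of `Λ +
ε`, extended by `ε⁻¹` on the diagonal off `F`, belongs to `kernelFamily Ψ`
(`diagExtend_mem_kernelFamily`). Applying (i) to it and letting `ε → 0` gives the same inequality
for `φ`, which contradicts the separation at the vector `δ`.

(iiF) → (iiG) is weak-* compactness. The diagonal of `Γ ⋆̂ ([1] - EE*)` bounds `Γ`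
(`exists_kernel_bound`), so an ultrafilter limit of the local kernels exists. The same limit shows
that the cone above is closed.

(iiG) → (iii) is the lurking isometry. Write `Γ(x,y)(g) = ⟨ρ(g)L(x), L(y)⟩` and `W = ρ(E) ⋆ L`. The
identity says that `(W(x), δ(x)) ↦ (L(x), φ(x))` preserves inner products. A unitary extension
yields a colligation, and solving for `L` identifies `φ` as its transfer function.

(iii) → (i): unitarity gives `[1] - φφ*` in terms of vectors `r` standing to the left of `[1] - EE*`
(`UnitaryColligation.exists_left_vectors`). After the product with `k`, the inner factor `([1] -
EE*) ⋆ k` is a matrix over `C_b(Ψ)` that is positive at each `ψ`, hence of the form `SS*`, and the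
product becomes a sum of Gram matrices. -/

theorem isIdem_of_pmul_eq_self_left {a f : G} (hf : pmul f a = some a) : IsIdem f := by
  let S := {y : G // pmul y a = some a}
  have key : ∀ y y' : S, ∃ z : S, pmul y.1 y'.1 = some z.1 := by
    intro y y'
    have h := Semigroupoid.assoc y.1 y'.1 a
    simp only [pmul₃, y.2, Option.bind_some, y'.2] at h
    rcases hz : pmul y.1 y'.1 with _ | z
    · simp [hz] at h
    · simp only [hz, Option.bind_some] at h
      exact ⟨⟨z, h⟩, rfl⟩
  choose m hm using key
  have : Finite S := by
    have hfin := (finite_pairs a).preimage (f := fun y : G => (y, a))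
      (fun y _ y' _ h => by simpa using h)
    exact hfin.to_subtype
  let _ : Semigroup S :=
    { mul := m
      mul_assoc := by
        intro x y z
        have h := Semigroupoid.assoc x.1 y.1 z.1
        simp only [pmul₃, hm, Option.bind_some, Option.some.injEq] at h
        exact Subtype.ext h }
  let _ : TopologicalSpace S := ⊥
  have : DiscreteTopology S := ⟨rfl⟩
  let f' : S := ⟨f, hf⟩
  -- The left units of `a` form a finite semigroup, so its right ideal generated by `f` contains an
  -- idempotent `fy`. The absence of inverses then forces `f = fy`.
  obtain ⟨e, ⟨y, rfl⟩, he⟩ := exists_idempotent_in_compact_subsemigroup (M := S)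
    (fun _ => continuous_of_discreteTopology) (Set.range fun y => f' * y) ⟨f' * f', f', rfl⟩
    (Set.toFinite _).isCompact
    (by rintro _ ⟨x, rfl⟩ _ ⟨y, rfl⟩; exact ⟨x * (f' * y), by simp only [mul_assoc]⟩)
  have hidem : IsIdem (f' * y).1 := by
    apply Semigroupoid.idem_of_sq
    rw [hm]
    exact congrArg (fun s : S => some s.1) he
  have h := (Semigroupoid.no_inverses f y.1 _ hidem (hm f' y)).1
  rw [h]
  exact hidem

/-- The idempotent `e` with `ex = x`. -/
noncomputable def leftUnit (x : G) : G := (Semigroupoid.exists_idem x).choose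

/-- The idempotent `f` with `xf = x`. -/
noncomputable def rightUnit (x : G) : G := (Semigroupoid.exists_idem x).choose_spec.choose

theorem pmul_leftUnit (x : G) : pmul (leftUnit x) x = some x :=
  (Semigroupoid.exists_idem x).choose_spec.choose_spec.1

theorem pmul_rightUnit (x : G) : pmul x (rightUnit x) = some x :=
  (Semigroupoid.exists_idem x).choose_spec.choose_spec.2

theorem isIdem_leftUnit (x : G) : IsIdem (leftUnit x) :=
  isIdem_of_pmul_eq_self_left (pmul_leftUnit x)

theorem isIdem_rightUnit (x : G) : IsIdem (rightUnit x) :=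
  isIdem_of_pmul_eq_self (pmul_rightUnit x)

/-- Associativity makes the product of the two left units defined, and since both are idempotent it
equals each of them. -/
theorem eq_leftUnit {e x : G} (h : pmul e x = some x) : e = leftUnit x := by
  have h1 := Semigroupoid.assoc e (leftUnit x) x
  simp only [pmul₃, pmul_leftUnit, Option.bind_some, h] at h1
  obtain ⟨m, hm, -⟩ := Option.bind_eq_some_iff.1 h1
  rw [← (isIdem_leftUnit x).2 _ _ hm, (isIdem_of_pmul_eq_self_left h).1 _ _ hm]

theorem eq_rightUnit {e x : G} (h : pmul x e = some x) : e = rightUnit x := by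
  have h1 := Semigroupoid.assoc x (rightUnit x) e
  simp only [pmul₃, pmul_rightUnit, Option.bind_some, h] at h1
  obtain ⟨m, hm, -⟩ := Option.bind_eq_some_iff.1 h1.symm
  rw [← (isIdem_rightUnit x).1 _ _ hm, (isIdem_of_pmul_eq_self h).2 _ _ hm]

theorem leftUnit_eq_self {e : G} (he : IsIdem e) : leftUnit e = e :=
  (he.2 _ _ (pmul_leftUnit e)).symm

/-- `x = pq` with a factor `p` that is not idempotent. -/
def LeftLt (q x : G) : Prop := ∃ p, ¬ IsIdem p ∧ pmul p q = some x

theorem LeftLt.precedes {q x : G} (h : LeftLt q x) : Precedes q x := by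
  obtain ⟨p, -, h⟩ := h
  refine ⟨p, rightUnit x, ?_⟩
  simp [pmul₃, h, pmul_rightUnit]

theorem LeftLt.trans {a b c : G} (h₁ : LeftLt a b) (h₂ : LeftLt b c) : LeftLt a c := by
  obtain ⟨p, hp, h₁⟩ := h₁
  obtain ⟨p', hp', h₂⟩ := h₂
  have h := Semigroupoid.assoc p' p a
  simp only [pmul₃, h₁, Option.bind_some, h₂] at h
  obtain ⟨m, hm, hm'⟩ := Option.bind_eq_some_iff.1 h
  -- An idempotent product `p'p` would equal its factor `p'`, which is not idempotent.
  exact ⟨m, fun hi => hp' ((Semigroupoid.no_inverses _ _ _ hi hm).1 ▸ hi), hm'⟩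

theorem LeftLt.irrefl (a : G) : ¬ LeftLt a a := fun ⟨_, hp, h⟩ =>
  hp (isIdem_of_pmul_eq_self_left h)

theorem wellFounded_leftLt : WellFounded (LeftLt : G → G → Prop) := by
  have : IsStrictOrder G LeftLt :=
    { irrefl := LeftLt.irrefl, trans := fun _ _ _ => LeftLt.trans }
  refine ⟨fun a => ?_⟩
  have hfin := finite_precedes a
  have hwf := hfin.wellFoundedOn (r := (LeftLt : G → G → Prop))
  refine (Set.WellFoundedOn.acc_iff_wellFoundedOn (r := LeftLt) (a := a)).out 0 2 |>.2 ?_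
  refine hwf.subset ?_
  intro b hb
  have : LeftLt b a := by
    have hb' : Relation.TransGen LeftLt b a := hb
    induction hb' with
    | single h => exact h
    | tail _ h ih => exact LeftLt.trans (ih (finite_precedes _) (finite_precedes _).wellFoundedOn ‹_›) h
  exact this.precedes

/-- Definition of a function by recursion along `LeftLt`. -/
theorem exists_leftLt_rec {M : Type*} [Inhabited M] (Φ : G → (G → M) → M)
    (hΦ : ∀ x g g', (∀ q, LeftLt q x → g q = g' q) → Φ x g = Φ x g') :
    ∃ g : G → M, ∀ x, g x = Φ x g := by
  classical
  -- The default off the predecessors of `x` is immaterial, since by `hΦ` only values at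
  -- predecessors matter.
  refine ⟨wellFounded_leftLt.fix fun x ih =>
    Φ x fun q => if h : LeftLt q x then ih q h else default, fun x => ?_⟩
  rw [WellFounded.fix_eq]
  refine hΦ _ _ _ fun q hq => ?_
  rw [dif_pos hq]

end Order

/-! ## Sums over factorizations -/

section Sums

open PartialMul

variable {G : Type u} [Semigroupoid G]

open Classical in
/-- The factorizations of `x` whose left factor is not idempotent. -/
noncomputable def properPairs (x : G) : Finset (G × G) :=
  (factorPairs x).filter fun p => ¬ IsIdem p.1

theorem leftLt_of_mem_properPairs {x : G} {p : G × G} (h : p ∈ properPairs x) :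
    LeftLt p.2 x := by
  simp only [properPairs, Finset.mem_filter, mem_factorPairs] at h
  exact ⟨p.1, h.2, h.1⟩

theorem pmul_of_mem_properPairs {x : G} {p : G × G} (h : p ∈ properPairs x) :
    pmul p.1 p.2 = some x := by
  simp only [properPairs, Finset.mem_filter, mem_factorPairs] at h
  exact h.1

open Classical in
theorem filter_factorPairs_idem_left (x : G) :
    (factorPairs x).filter (fun p => IsIdem p.1) = {(leftUnit x, x)} := by
  ext ⟨p, q⟩
  simp only [Finset.mem_filter, mem_factorPairs, Finset.mem_singleton, Prod.mk.injEq]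
  constructor
  · rintro ⟨h, hp⟩
    have := hp.1 _ _ h
    subst this
    exact ⟨eq_leftUnit h, rfl⟩
  · rintro ⟨rfl, rfl⟩
    exact ⟨pmul_leftUnit _, isIdem_leftUnit _⟩

open Classical in
theorem filter_factorPairs_idem_right (x : G) :
    (factorPairs x).filter (fun p => IsIdem p.2) = {(x, rightUnit x)} := by
  ext ⟨p, q⟩
  simp only [Finset.mem_filter, mem_factorPairs, Finset.mem_singleton, Prod.mk.injEq]
  constructor
  · rintro ⟨h, hp⟩
    have := hp.2 _ _ h
    subst this
    exact ⟨rfl, eq_rightUnit h⟩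
  · rintro ⟨rfl, rfl⟩
    exact ⟨pmul_rightUnit _, isIdem_rightUnit _⟩

/-- Isolates the diagonal term. Every remaining right factor is `LeftLt` below `x`, so a convolution
identity at `x` becomes a recursion. -/
theorem sum_factorPairs_split {M : Type*} [AddCommMonoid M] (x : G) (F : G × G → M) :
    ∑ p ∈ factorPairs x, F p = F (leftUnit x, x) + ∑ p ∈ properPairs x, F p := by
  classical
  rw [← Finset.sum_filter_add_sum_filter_not (factorPairs x) (fun p => IsIdem p.1),
    filter_factorPairs_idem_left, Finset.sum_singleton]
  rfl

theorem sum_factorPairs_of_left_idem {M : Type*} [AddCommMonoid M] (x : G) (F : G × G → M)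
    (hF : ∀ p, ¬ IsIdem p.1 → F p = 0) : ∑ p ∈ factorPairs x, F p = F (leftUnit x, x) := by
  classical
  rw [← Finset.sum_filter_add_sum_filter_not (factorPairs x) (fun p => IsIdem p.1),
    filter_factorPairs_idem_left, Finset.sum_singleton, Finset.sum_eq_zero, add_zero]
  intro p hp
  exact hF p (Finset.mem_filter.1 hp).2

theorem sum_factorPairs_of_right_idem {M : Type*} [AddCommMonoid M] (x : G) (F : G × G → M)
    (hF : ∀ p, ¬ IsIdem p.2 → F p = 0) : ∑ p ∈ factorPairs x, F p = F (x, rightUnit x) := by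
  classical
  rw [← Finset.sum_filter_add_sum_filter_not (factorPairs x) (fun p => IsIdem p.2),
    filter_factorPairs_idem_right, Finset.sum_singleton, Finset.sum_eq_zero, add_zero]
  intro p hp
  exact hF p (Finset.mem_filter.1 hp).2

/-- Both sides run over the triples with `zbw = a`; the associative law says that the two
bracketings are defined simultaneously. -/
theorem sum_factorPairs_assoc {M : Type*} [AddCommMonoid M] (a : G) (F : G → G → G → M) :
    ∑ p ∈ factorPairs a, ∑ u ∈ factorPairs p.1, F u.1 u.2 p.2 =
      ∑ p ∈ factorPairs a, ∑ v ∈ factorPairs p.2, F p.1 v.1 v.2 := by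
  rw [Finset.sum_sigma', Finset.sum_sigma']
  have h1 : ∀ z b w m : G, pmul z b = some m → pmul m w = some a →
      ∃ n, pmul b w = some n ∧ pmul z n = some a := by
    intro z b w m h h'
    have := Semigroupoid.assoc z b w
    simp only [pmul₃, h, Option.bind_some, h'] at this
    exact Option.bind_eq_some_iff.1 this.symm
  have h2 : ∀ z b w n : G, pmul b w = some n → pmul z n = some a →
      ∃ m, pmul z b = some m ∧ pmul m w = some a := by
    intro z b w m h h'
    have := Semigroupoid.assoc z b w
    simp only [pmul₃, h, Option.bind_some, h'] at this
    exact Option.bind_eq_some_iff.1 this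
  -- The value `a` in `getD` is never taken: on the index sets all these products are defined.
  refine Finset.sum_bij'
    (i := fun (s : Σ _ : G × G, G × G) _ => (⟨(s.2.1, (pmul s.2.2 s.1.2).getD a), (s.2.2, s.1.2)⟩ : Σ _ : G × G, G × G))
    (j := fun (s : Σ _ : G × G, G × G) _ => (⟨((pmul s.1.1 s.2.1).getD a, s.2.2), (s.1.1, s.2.1)⟩ : Σ _ : G × G, G × G))
    ?_ ?_ ?_ ?_ ?_
  · rintro ⟨⟨m, w⟩, ⟨z, b⟩⟩ h
    simp only [Finset.mem_sigma, mem_factorPairs] at h ⊢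
    obtain ⟨n, hn, hn'⟩ := h1 z b w m h.2 h.1
    simp [hn, hn']
  · rintro ⟨⟨z, n⟩, ⟨b, w⟩⟩ h
    simp only [Finset.mem_sigma, mem_factorPairs] at h ⊢
    obtain ⟨m, hn, hn'⟩ := h2 z b w n h.2 h.1
    simp [hn, hn']
  · rintro ⟨⟨m, w⟩, ⟨z, b⟩⟩ h
    simp only [Finset.mem_sigma, mem_factorPairs] at h ⊢
    simp [h.2]
  · rintro ⟨⟨z, n⟩, ⟨b, w⟩⟩ h
    simp only [Finset.mem_sigma, mem_factorPairs] at h ⊢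
    simp [h.2]
  · intros; rfl

end Sums

/-! ## The convolution product -/

section Conv

open PartialMul

variable {G : Type u} [Semigroupoid G]

theorem conv_assoc {A M : Type*} [Ring A] [AddCommGroup M] [Module A M]
    (f g : G → A) (h : G → M) : conv (conv f g) h = conv f (conv g h) := by
  funext a
  simp only [conv, Finset.sum_smul, Finset.smul_sum]
  rw [← sum_factorPairs_assoc a (fun u v w => f u • g v • h w)]
  simp only [smul_eq_mul, mul_smul]

theorem deltaFun_of_isIdem {A : Type*} [Zero A] [One A] {x : G} (hx : IsIdem x) :
    deltaFun A x = 1 := if_pos hx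

theorem deltaFun_of_not_isIdem {A : Type*} [Zero A] [One A] {x : G} (hx : ¬ IsIdem x) :
    deltaFun A x = 0 := if_neg hx

theorem delta_conv {A M : Type*} [Ring A] [AddCommGroup M] [Module A M] (h : G → M) :
    conv (deltaFun A) h = h := by
  funext a
  rw [conv, sum_factorPairs_of_left_idem]
  · simp [deltaFun_of_isIdem (isIdem_leftUnit a)]
  · intro p hp
    simp [deltaFun_of_not_isIdem hp]

theorem conv_delta {A : Type*} [Ring A] (f : G → A) : conv f (deltaFun A) = f := by
  funext a
  rw [conv, sum_factorPairs_of_right_idem]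
  · simp [deltaFun_of_isIdem (isIdem_rightUnit a)]
  · intro p hp
    simp [deltaFun_of_not_isIdem hp]

theorem conv_split {A M : Type*} [Ring A] [AddCommGroup M] [Module A M] (f : G → A) (h : G → M)
    (x : G) : conv f h x = f (leftUnit x) • h x + ∑ p ∈ properPairs x, f p.1 • h p.2 :=
  sum_factorPairs_split x _

theorem properPairs_of_isIdem {e : G} (he : IsIdem e) : properPairs e = ∅ := by
  rw [Finset.eq_empty_iff_forall_notMem]
  intro p hp
  have h := Semigroupoid.no_inverses _ _ _ he (pmul_of_mem_properPairs hp)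
  obtain ⟨q, hq, hq'⟩ := leftLt_of_mem_properPairs hp
  rw [h.2] at hq'
  exact hq (isIdem_of_pmul_eq_self_left hq')

/-- Left convolution by `f` is triangular for `LeftLt`, with diagonal entry `f (leftUnit x)` at `x`,
so the system is solved by forward substitution. -/
theorem exists_conv_eq {A M : Type*} [Ring A] [AddCommGroup M] [Module A M] (f : G → A)
    (hf : ∀ e, IsIdem e → IsUnit (f e)) (h : G → M) : ∃ g : G → M, conv f g = h := by
  have : Inhabited M := ⟨0⟩
  obtain ⟨g, hg⟩ := exists_leftLt_rec (fun x (g : G → M) =>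
    Ring.inverse (f (leftUnit x)) • (h x - ∑ p ∈ properPairs x, f p.1 • g p.2)) (by
      intro x g g' hgg
      rw [Finset.sum_congr rfl]
      intro p hp
      rw [hgg _ (leftLt_of_mem_properPairs hp)])
  refine ⟨g, funext fun x => ?_⟩
  rw [conv_split, hg x, smul_smul, Ring.mul_inverse_cancel _ (hf _ (isIdem_leftUnit x)), one_smul]
  simp

/-- Substitution gives only a right inverse `g`. Its values at idempotents are again units, so `g`
has a right inverse too, which associativity identifies with `f`. -/
theorem exists_isStarInverse {A : Type*} [Ring A] (f : G → A)
    (hf : ∀ e, IsIdem e → IsUnit (f e)) : ∃ g, IsStarInverse f g := by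
  obtain ⟨g, hg⟩ := exists_conv_eq f hf (deltaFun A)
  have hu : ∀ e, IsIdem e → IsUnit (g e) := by
    intro e he
    have h := congrFun hg e
    rw [conv_split, properPairs_of_isIdem he, deltaFun_of_isIdem he, leftUnit_eq_self he] at h
    simp only [smul_eq_mul, Finset.sum_empty, add_zero] at h
    obtain ⟨v, hv⟩ := hf e he
    rw [← hv, Units.mul_eq_one_iff_inv_eq] at h
    exact ⟨v⁻¹, h⟩
  obtain ⟨k, hk⟩ := exists_conv_eq g hu (deltaFun A)
  have : f = k := by
    rw [← conv_delta f, ← hk, ← conv_assoc, hg, delta_conv]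
  exact ⟨g, hg, this ▸ hk⟩

theorem isStarInverse_starInv {A : Type*} [Ring A] (f : G → A)
    (hf : ∀ e, IsIdem e → IsUnit (f e)) : IsStarInverse f (starInv f) := by
  rw [starInv, dif_pos (exists_isStarInverse f hf)]
  exact (exists_isStarInverse f hf).choose_spec

end Conv

/-! ## Kolmogorov decomposition of positive kernels -/

section Kolmogorov

variable {X : Type u} {Y : Type u} [TopologicalSpace Y]

/-- The function `√(‖g‖² - |g|²)` serves. It turns positivity of a kernel into boundedness of
multiplication by `g`. -/
theorem exists_mul_star_eq_norm_sq_sub (g : Y →ᵇ ℂ) : ∃ h : Y →ᵇ ℂ,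
    h * star h = ((‖g‖ : ℂ) ^ 2) • (1 : Y →ᵇ ℂ) - g * star g := by
  have hle : ∀ y, ‖g y‖ ^ 2 ≤ ‖g‖ ^ 2 := fun y => by
    have := g.norm_coe_le_norm y
    gcongr
  refine ⟨BoundedContinuousFunction.ofNormedAddCommGroup
    (fun y => ((√(‖g‖ ^ 2 - ‖g y‖ ^ 2) : ℝ) : ℂ)) (by fun_prop) ‖g‖ ?_, ?_⟩
  · intro y
    rw [Complex.norm_real, Real.norm_of_nonneg (Real.sqrt_nonneg _)]
    rw [Real.sqrt_le_left (norm_nonneg _)]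
    have := sq_nonneg ‖g y‖
    linarith
  · ext y
    have h := Real.mul_self_sqrt (sub_nonneg.2 (hle y))
    have h2 : g y * (starRingEnd ℂ) (g y) = ((‖g y‖ ^ 2 : ℝ) : ℂ) := by
      rw [Complex.mul_conj, Complex.normSq_eq_norm_sq]
    simp only [BoundedContinuousFunction.coe_mul, Pi.mul_apply,
      BoundedContinuousFunction.coe_ofNormedAddCommGroup, BoundedContinuousFunction.star_apply,
      BoundedContinuousFunction.coe_sub, Pi.sub_apply, BoundedContinuousFunction.coe_smul,
      BoundedContinuousFunction.coe_one, Pi.one_apply, RCLike.star_def, Complex.conj_ofReal,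
      smul_eq_mul, mul_one]
    rw [← Complex.ofReal_mul, h, h2]
    push_cast
    rfl

/-- The form `∑ Γ(x,y)(f(x) h(y)*)`. -/
noncomputable def kernelForm (Γ : X → X → StrongDual ℂ (Y →ᵇ ℂ)) (f h : X →₀ (Y →ᵇ ℂ)) : ℂ :=
  f.sum fun x u => h.sum fun y v => Γ x y (u * star v)

variable (Γ : X → X → StrongDual ℂ (Y →ᵇ ℂ))

theorem kernelForm_add_left (f f' h : X →₀ (Y →ᵇ ℂ)) :
    kernelForm Γ (f + f') h = kernelForm Γ f h + kernelForm Γ f' h := by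
  classical
  unfold kernelForm
  rw [Finsupp.sum_add_index']
  · simp
  · intro x u v
    simp [add_mul, Finsupp.sum_add]

theorem kernelForm_add_right (f h h' : X →₀ (Y →ᵇ ℂ)) :
    kernelForm Γ f (h + h') = kernelForm Γ f h + kernelForm Γ f h' := by
  classical
  unfold kernelForm
  rw [← Finsupp.sum_add]
  congr 1
  funext x u
  rw [Finsupp.sum_add_index']
  · simp
  · simp [mul_add]

theorem kernelForm_smul_left (c : ℂ) (f h : X →₀ (Y →ᵇ ℂ)) :
    kernelForm Γ (c • f) h = c * kernelForm Γ f h := by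
  unfold kernelForm
  rw [Finsupp.sum_smul_index' (by simp), Finsupp.mul_sum]
  congr 1
  funext x u
  rw [Finsupp.mul_sum]
  simp

theorem kernelForm_smul_right (c : ℂ) (f h : X →₀ (Y →ᵇ ℂ)) :
    kernelForm Γ f (c • h) = star c * kernelForm Γ f h := by
  unfold kernelForm
  rw [Finsupp.mul_sum]
  congr 1
  funext x u
  rw [Finsupp.sum_smul_index' (by simp), Finsupp.mul_sum]
  simp

theorem kernelForm_single (x y : X) (u v : Y →ᵇ ℂ) :
    kernelForm Γ (Finsupp.single x u) (Finsupp.single y v) = Γ x y (u * star v) := by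
  unfold kernelForm
  rw [Finsupp.sum_single_index, Finsupp.sum_single_index] <;> simp

/-- Multiplication by an element of the algebra. -/
noncomputable def finsuppMul (g : Y →ᵇ ℂ) : (X →₀ (Y →ᵇ ℂ)) →ₗ[ℂ] (X →₀ (Y →ᵇ ℂ)) :=
  Finsupp.mapRange.linearMap (LinearMap.mulLeft ℂ g)

theorem finsuppMul_single (g : Y →ᵇ ℂ) (x : X) (u : Y →ᵇ ℂ) :
    finsuppMul g (Finsupp.single x u) = Finsupp.single x (g * u) := by
  simp [finsuppMul]

theorem kernelForm_mul (g g' : Y →ᵇ ℂ) (f h : X →₀ (Y →ᵇ ℂ)) :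
    kernelForm Γ (finsuppMul g f) (finsuppMul g' h) =
      f.sum fun x u => h.sum fun y v => Γ x y (g * star g' * (u * star v)) := by
  unfold kernelForm
  simp only [finsuppMul, Finsupp.mapRange.linearMap_apply]
  rw [Finsupp.sum_mapRange_index (by simp)]
  congr 1
  funext x u
  rw [Finsupp.sum_mapRange_index (by simp)]
  congr 1
  funext y v
  congr 1
  simp only [LinearMap.mulLeft_apply, star_mul]
  ring

variable {Γ}

theorem kernelForm_nonneg (hΓ : IsPosDualKernel Γ) (f : X →₀ (Y →ᵇ ℂ)) : 0 ≤ kernelForm Γ f f :=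
  hΓ f.support f

/-- Polarization: the form takes real values on the diagonal, in particular at `f`, `h`, `f + h` and
`f + ih`. -/
theorem kernelForm_symm (hΓ : IsPosDualKernel Γ) (f h : X →₀ (Y →ᵇ ℂ)) :
    kernelForm Γ f h = star (kernelForm Γ h f) := by
  have h1 := (Complex.le_def.1 (kernelForm_nonneg hΓ (f + h))).2
  have h2 := (Complex.le_def.1 (kernelForm_nonneg hΓ (f + Complex.I • h))).2
  have h3 := (Complex.le_def.1 (kernelForm_nonneg hΓ f)).2
  have h4 := (Complex.le_def.1 (kernelForm_nonneg hΓ h)).2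
  simp only [kernelForm_add_left, kernelForm_add_right, kernelForm_smul_left,
    kernelForm_smul_right, Complex.add_im, Complex.zero_im, Complex.mul_im, Complex.I_re,
    Complex.I_im, Complex.star_def, Complex.conj_I, Complex.neg_re, Complex.neg_im,
    Complex.mul_re, Complex.add_re] at h1 h2 h3 h4
  apply Complex.ext
  · simp only [Complex.star_def, Complex.conj_re]
    linarith
  · simp only [Complex.star_def, Complex.conj_im]
    linarith

/-- The difference of the two sides is the form at `hf`, where `hh* = ‖g‖² - gg*`. -/
theorem kernelForm_mul_le (hΓ : IsPosDualKernel Γ) (g : Y →ᵇ ℂ) (f : X →₀ (Y →ᵇ ℂ)) :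
    kernelForm Γ (finsuppMul g f) (finsuppMul g f) ≤ (‖g‖ : ℂ) ^ 2 * kernelForm Γ f f := by
  obtain ⟨h, hh⟩ := exists_mul_star_eq_norm_sq_sub g
  have := kernelForm_nonneg hΓ (finsuppMul h f)
  rw [kernelForm_mul, hh] at this
  simp only [sub_mul, map_sub, smul_mul_assoc, one_mul, map_smul, Finsupp.sum_sub,
    sub_nonneg] at this
  rw [kernelForm_mul]
  refine this.trans_eq ?_
  rw [kernelForm, Finsupp.mul_sum]
  congr 1
  funext x u
  rw [Finsupp.mul_sum]
  rfl

set_option linter.unusedVariables false in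
/-- The space `X →₀ C_b(Y)`, to be equipped with the inner product given by a positive kernel. -/
@[nolint unusedArguments]
def PreKolmogorov (hΓ : IsPosDualKernel Γ) : Type u := X →₀ (Y →ᵇ ℂ)

namespace PreKolmogorov

variable (hΓ : IsPosDualKernel Γ)

noncomputable instance : AddCommGroup (PreKolmogorov hΓ) :=
  inferInstanceAs (AddCommGroup (X →₀ (Y →ᵇ ℂ)))

noncomputable instance : Module ℂ (PreKolmogorov hΓ) :=
  inferInstanceAs (Module ℂ (X →₀ (Y →ᵇ ℂ)))

/-- The identification of `PreKolmogorov hΓ` with `X →₀ C_b(Y)`. -/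
noncomputable def of : (X →₀ (Y →ᵇ ℂ)) ≃ₗ[ℂ] PreKolmogorov hΓ := LinearEquiv.refl ℂ _

/-- The inner product given by the kernel. -/
noncomputable abbrev core : PreInnerProductSpace.Core ℂ (PreKolmogorov hΓ) where
  -- The arguments are exchanged because the inner product is conjugate-linear in its first variable
  -- and `kernelForm` in its second.
  inner a b := kernelForm Γ ((of hΓ).symm b) ((of hΓ).symm a)
  conj_inner_symm a b := (kernelForm_symm hΓ _ _).symm
  re_inner_nonneg a := (Complex.le_def.1 (kernelForm_nonneg hΓ ((of hΓ).symm a))).1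
  add_left a b c := by rw [map_add, kernelForm_add_right]
  smul_left a b c := by rw [map_smul, kernelForm_smul_right]; rfl

noncomputable instance : SeminormedAddCommGroup (PreKolmogorov hΓ) :=
  InnerProductSpace.Core.toSeminormedAddCommGroup (c := core hΓ)

noncomputable instance : InnerProductSpace ℂ (PreKolmogorov hΓ) :=
  InnerProductSpace.ofCore (core hΓ)

theorem inner_def (a b : PreKolmogorov hΓ) :
    inner ℂ a b = kernelForm Γ ((of hΓ).symm b) ((of hΓ).symm a) := rfl

theorem norm_sq (a : PreKolmogorov hΓ) :
    ((‖a‖ : ℂ)) ^ 2 = kernelForm Γ ((of hΓ).symm a) ((of hΓ).symm a) := by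
  rw [← inner_def, inner_self_eq_norm_sq_to_K]
  rfl

/-- Multiplication operators on the pre-Hilbert space of a positive kernel. -/
noncomputable def mulCLM (g : Y →ᵇ ℂ) : PreKolmogorov hΓ →L[ℂ] PreKolmogorov hΓ :=
  LinearMap.mkContinuous ((of hΓ).toLinearMap ∘ₗ finsuppMul g ∘ₗ (of hΓ).symm.toLinearMap) ‖g‖
    fun a => by
      have h := kernelForm_mul_le hΓ g ((of hΓ).symm a)
      rw [← norm_sq] at h
      have h2 := norm_sq hΓ (of hΓ (finsuppMul g ((of hΓ).symm a)))
      simp only [LinearEquiv.symm_apply_apply] at h2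
      rw [← h2] at h
      have h3 : ‖of hΓ (finsuppMul g ((of hΓ).symm a))‖ ^ 2 ≤ ‖g‖ ^ 2 * ‖a‖ ^ 2 := by
        exact_mod_cast h
      rw [← mul_pow] at h3
      exact le_of_sq_le_sq h3 (by positivity)

theorem mulCLM_apply (g : Y →ᵇ ℂ) (a : PreKolmogorov hΓ) :
    mulCLM hΓ g a = of hΓ (finsuppMul g ((of hΓ).symm a)) := rfl

end PreKolmogorov

open PreKolmogorov UniformSpace

theorem finsuppMul_add (g g' : Y →ᵇ ℂ) (f : X →₀ (Y →ᵇ ℂ)) :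
    finsuppMul (g + g') f = finsuppMul g f + finsuppMul g' f := by
  ext x : 1
  simp [finsuppMul, add_mul]

theorem finsuppMul_mul (g g' : Y →ᵇ ℂ) (f : X →₀ (Y →ᵇ ℂ)) :
    finsuppMul (g * g') f = finsuppMul g (finsuppMul g' f) := by
  ext x : 1
  simp [finsuppMul]

theorem finsuppMul_algebraMap (c : ℂ) (f : X →₀ (Y →ᵇ ℂ)) :
    finsuppMul (algebraMap ℂ (Y →ᵇ ℂ) c) f = c • f := by
  ext x : 1
  simp [finsuppMul, Algebra.algebraMap_eq_smul_one]

theorem kernelForm_mul_star (g : Y →ᵇ ℂ) (f h : X →₀ (Y →ᵇ ℂ)) :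
    kernelForm Γ f (finsuppMul (star g) h) = kernelForm Γ (finsuppMul g f) h := by
  have h1 : ∀ f : X →₀ (Y →ᵇ ℂ), finsuppMul 1 f = f := fun f => by
    ext x : 1
    simp [finsuppMul]
  calc kernelForm Γ f (finsuppMul (star g) h)
      = kernelForm Γ (finsuppMul 1 f) (finsuppMul (star g) h) := by rw [h1]
    _ = kernelForm Γ (finsuppMul g f) (finsuppMul 1 h) := by
        rw [kernelForm_mul, kernelForm_mul]
        simp
    _ = _ := by rw [h1]

/-- The representation on the Hilbert space of a positive kernel. -/
noncomputable def kolmogorovRep (hΓ : IsPosDualKernel Γ) :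
    (Y →ᵇ ℂ) →⋆ₐ[ℂ] (Completion (PreKolmogorov hΓ) →L[ℂ] Completion (PreKolmogorov hΓ)) where
  toFun g := (mulCLM hΓ g).completion
  map_one' := by
    ext c
    induction c using Completion.induction_on with
    | hp => exact isClosed_eq (by fun_prop) (by fun_prop)
    | ih c =>
      have := finsuppMul_algebraMap (X := X) (Y := Y) 1 ((of hΓ).symm c)
      rw [map_one, one_smul] at this
      simp [mulCLM_apply, this]
  map_zero' := by
    ext c
    induction c using Completion.induction_on with
    | hp => exact isClosed_eq (by fun_prop) (by fun_prop)
    | ih c =>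
      have := finsuppMul_algebraMap (X := X) (Y := Y) 0 ((of hΓ).symm c)
      rw [map_zero, zero_smul] at this
      simp [mulCLM_apply, this, Completion.coe_zero]
  map_add' g g' := by
    ext c
    induction c using Completion.induction_on with
    | hp => exact isClosed_eq (by fun_prop) (by fun_prop)
    | ih c => simp [mulCLM_apply, finsuppMul_add, Completion.coe_add]
  map_mul' g g' := by
    ext c
    induction c using Completion.induction_on with
    | hp => exact isClosed_eq (by fun_prop) (by fun_prop)
    | ih c => simp [mulCLM_apply, finsuppMul_mul]
  commutes' r := by
    ext c
    induction c using Completion.induction_on with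
    | hp => exact isClosed_eq (by fun_prop) (by fun_prop)
    | ih c =>
      have := finsuppMul_algebraMap (X := X) (Y := Y) r ((of hΓ).symm c)
      rw [ContinuousLinearMap.algebraMap_apply, ContinuousLinearMap.completion_apply_coe,
        mulCLM_apply, this, map_smul, LinearEquiv.apply_symm_apply, Completion.coe_smul]
  map_star' g := by
    refine (ContinuousLinearMap.eq_adjoint_iff _ _).mpr ?_
    intro x y
    induction x, y using Completion.induction_on₂ with
    | hp => apply isClosed_eq <;> fun_prop
    | ih x y =>
      simp [mulCLM_apply, inner_def, kernelForm_mul_star]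

/-- The vector `L x` is the class of the function supported at `x` with value `1`; the completion
also removes the null vectors. -/
theorem exists_kolmogorov (hΓ : IsPosDualKernel Γ) :
    ∃ (ℰ : Type u) (_ : NormedAddCommGroup ℰ) (_ : InnerProductSpace ℂ ℰ) (_ : CompleteSpace ℰ)
      (ρ : (Y →ᵇ ℂ) →⋆ₐ[ℂ] (ℰ →L[ℂ] ℰ)) (L : X → ℰ),
      ∀ x y g, Γ x y g = inner ℂ (L y) (ρ g (L x)) := by
  refine ⟨Completion (PreKolmogorov hΓ), inferInstance, inferInstance, inferInstance,
    kolmogorovRep hΓ, fun x => ((of hΓ (Finsupp.single x 1) : PreKolmogorov hΓ) : Completion _), ?_⟩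
  intro x y g
  simp [kolmogorovRep, mulCLM_apply, inner_def, finsuppMul_single, kernelForm_single]

end Kolmogorov

/-! ## Unitary dilation of a partially defined isometry -/

section Dilation

variable {K : Type*} [NormedAddCommGroup K] [InnerProductSpace ℂ K] [CompleteSpace K]

/-- Equality of Gram matrices makes `∑ cᵢuᵢ ↦ ∑ cᵢvᵢ` well defined and isometric. It extends to the
closed span, and `T` is this extension preceded by the orthogonal projection. -/
theorem exists_partialIsometry {ι : Type*} (u v : ι → K)
    (h : ∀ i j, inner ℂ (u i) (u j) = inner ℂ (v i) (v j)) :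
    ∃ T : K →L[ℂ] K, (∀ i, T (u i) = v i) ∧ (∀ i, T.adjoint (v i) = u i) ∧
      ∀ k, T (T.adjoint (T k)) = T k := by
  let a := Finsupp.linearCombination ℂ u
  let b := Finsupp.linearCombination ℂ v
  have hin : ∀ f g, inner ℂ (a f) (a g) = inner ℂ (b f) (b g) := by
    intro f g
    simp only [a, b, Finsupp.linearCombination_apply, Finsupp.inner_sum, Finsupp.sum_inner,
      inner_smul_left, inner_smul_right, h]
  have hn : ∀ f, ‖b f‖ = ‖a f‖ := by
    intro f
    rw [← sq_eq_sq₀ (norm_nonneg _) (norm_nonneg _), ← inner_self_eq_norm_sq (𝕜 := ℂ),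
      ← inner_self_eq_norm_sq (𝕜 := ℂ), hin]
  let M := (LinearMap.range a).topologicalClosure
  have hM : ∀ f, a f ∈ M := fun f => Submodule.le_topologicalClosure _ ⟨f, rfl⟩
  let e : (ι →₀ ℂ) →ₗ[ℂ] M := a.codRestrict M hM
  have hdense : DenseRange e := by
    intro x
    rw [Topology.IsInducing.subtypeVal.closure_eq_preimage_closure_image]
    change (x : K) ∈ closure _
    have hx := x.2
    simp only [M, ← SetLike.mem_coe, Submodule.topologicalClosure_coe] at hx
    convert hx using 2
    ext y
    constructor
    · rintro ⟨_, ⟨f, rfl⟩, rfl⟩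
      exact ⟨f, rfl⟩
    · rintro ⟨f, rfl⟩
      exact ⟨e f, ⟨f, rfl⟩, rfl⟩
  have : CompleteSpace M := (Submodule.isClosed_topologicalClosure _).completeSpace_coe
  have hbd : ∃ C, ∀ f, ‖b f‖ ≤ C * ‖e f‖ := ⟨1, fun f => by
    rw [one_mul, hn]; rfl⟩
  let V : M →L[ℂ] K := b.extendOfNorm e
  have hV : ∀ f, V (e f) = b f := fun f => LinearMap.extendOfNorm_eq hdense hbd f
  have hVin : ∀ x y, inner ℂ (V x) (V y) = inner ℂ x y := by
    intro x y
    refine hdense.induction_on₂ (p := fun x y => inner ℂ (V x) (V y) = inner ℂ x y) ?_ ?_ x y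
    · exact isClosed_eq (by fun_prop) (by fun_prop)
    · intro f g
      rw [hV, hV, ← hin]
      rfl
  let P := M.orthogonalProjectionOnto
  let T : K →L[ℂ] K := V ∘L P
  have hP : ∀ m : M, P (m : K) = m := fun m =>
    Submodule.orthogonalProjectionOnto_mem_subspace_eq_self m
  have hTT : ∀ k, T.adjoint (T k) = P k := by
    intro k
    refine ext_inner_left ℂ fun w => ?_
    rw [ContinuousLinearMap.adjoint_inner_right]
    change inner ℂ (V _) (V _) = _
    rw [hVin, ← Submodule.inner_orthogonalProjectionOnto_eq_of_mem_right]
    rfl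
  have huT : ∀ i, T (u i) = v i := by
    intro i
    have ha : a (Finsupp.single i 1) = u i := by simp [a]
    have hb : b (Finsupp.single i 1) = v i := by simp [b]
    have he : ((e (Finsupp.single i 1) : M) : K) = u i := ha
    rw [← hb, ← hV, ← he]
    exact congrArg V (hP _)
  refine ⟨T, huT, ?_, ?_⟩
  · intro i
    rw [← huT, hTT]
    have ha : a (Finsupp.single i 1) = u i := by simp [a]
    have he : ((e (Finsupp.single i 1) : M) : K) = u i := ha
    rw [← he, hP]
  · intro k
    rw [hTT]
    exact congrArg V (hP _)

/-- The Halmos dilation of a partial isometry. -/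
theorem exists_unitary_of_partialIsometry (T : K →L[ℂ] K) (hT : ∀ k, T (T.adjoint (T k)) = T k) :
    ∃ U : WithLp 2 (K × K) ≃ₗᵢ[ℂ] WithLp 2 (K × K), ∀ k h, U (WithLp.toLp 2 (k, h)) =
      WithLp.toLp 2 (T k + (h - T (T.adjoint h)), (k - T.adjoint (T k)) + T.adjoint h) := by
  have hT' : ∀ k, T.adjoint (T (T.adjoint k)) = T.adjoint k := by
    intro k
    refine ext_inner_left ℂ fun w => ?_
    rw [ContinuousLinearMap.adjoint_inner_right, ← ContinuousLinearMap.adjoint_inner_left T,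
      ContinuousLinearMap.adjoint_inner_right, hT, ← ContinuousLinearMap.adjoint_inner_right]
  -- The block matrix with rows `(T, 1 - TT*)` and `(1 - T*T, T*)`. For a partial isometry the
  -- defect operators are projections, so no square roots occur. The map `g` below is its adjoint.
  let f : WithLp 2 (K × K) →ₗ[ℂ] WithLp 2 (K × K) :=
    { toFun := fun p => WithLp.toLp 2
        (T p.fst + (p.snd - T (T.adjoint p.snd)), (p.fst - T.adjoint (T p.fst)) + T.adjoint p.snd)
      map_add' := by
        intro p q
        refine (WithLp.ext_iff ..).2 (Prod.ext ?_ ?_) <;> simp <;> abel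
      map_smul' := by
        intro c p
        refine (WithLp.ext_iff ..).2 (Prod.ext ?_ ?_) <;> simp [smul_sub] }
  let g : WithLp 2 (K × K) →ₗ[ℂ] WithLp 2 (K × K) :=
    { toFun := fun p => WithLp.toLp 2
        (T.adjoint p.fst + (p.snd - T.adjoint (T p.snd)), (p.fst - T (T.adjoint p.fst)) + T p.snd)
      map_add' := by
        intro p q
        refine (WithLp.ext_iff ..).2 (Prod.ext ?_ ?_) <;> simp <;> abel
      map_smul' := by
        intro c p
        refine (WithLp.ext_iff ..).2 (Prod.ext ?_ ?_) <;> simp [smul_sub] }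
  have hgf : ∀ p, g (f p) = p := by
    intro p
    refine (WithLp.ext_iff ..).2 (Prod.ext ?_ ?_) <;> simp [f, g, hT, hT']
  have hfg : ∀ p, f (g p) = p := by
    intro p
    refine (WithLp.ext_iff ..).2 (Prod.ext ?_ ?_) <;> simp [f, g, hT, hT']
  have hin : ∀ p q, inner ℂ (f p) q = inner ℂ p (g q) := by
    intro p q
    have e1 : inner ℂ (T (T.adjoint p.snd)) q.fst = inner ℂ p.snd (T (T.adjoint q.fst)) := by
      rw [← ContinuousLinearMap.adjoint_inner_right, ContinuousLinearMap.adjoint_inner_left]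
    change inner ℂ (T p.fst + (p.snd - T (T.adjoint p.snd))) q.fst +
        inner ℂ ((p.fst - T.adjoint (T p.fst)) + T.adjoint p.snd) q.snd =
      inner ℂ p.fst (T.adjoint q.fst + (q.snd - T.adjoint (T q.snd))) +
        inner ℂ p.snd ((q.fst - T (T.adjoint q.fst)) + T q.snd)
    simp only [inner_add_left, inner_add_right, inner_sub_left, inner_sub_right,
      ContinuousLinearMap.adjoint_inner_left, ContinuousLinearMap.adjoint_inner_right, e1]
    ring
  have hnorm : ∀ p, ‖f p‖ = ‖p‖ := by
    intro p
    rw [← sq_eq_sq₀ (norm_nonneg _) (norm_nonneg _), ← inner_self_eq_norm_sq (𝕜 := ℂ),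
      ← inner_self_eq_norm_sq (𝕜 := ℂ), hin, hgf]
  let e : WithLp 2 (K × K) ≃ₗ[ℂ] WithLp 2 (K × K) :=
    { f with invFun := g, left_inv := hgf, right_inv := hfg }
  exact ⟨⟨e, hnorm⟩, fun k h => rfl⟩

/-- A Gram-preserving correspondence of vectors extends to a unitary operator on a larger space. -/
theorem exists_unitary_extension {ι : Type*} (u v : ι → K)
    (h : ∀ i j, inner ℂ (u i) (u j) = inner ℂ (v i) (v j)) :
    ∃ U : WithLp 2 (K × K) ≃ₗᵢ[ℂ] WithLp 2 (K × K),
      ∀ i, U (WithLp.toLp 2 (u i, 0)) = WithLp.toLp 2 (v i, 0) := by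
  obtain ⟨T, hT, hT', hTT⟩ := exists_partialIsometry u v h
  obtain ⟨U, hU⟩ := exists_unitary_of_partialIsometry T hTT
  refine ⟨U, fun i => ?_⟩
  rw [hU]
  simp [hT, hT']

end Dilation

/-! ## Colligations -/

section Transfer

open UnitaryColligation

variable {𝔅 : Type u} [Ring 𝔅] [Algebra ℂ 𝔅] [Star 𝔅] (S : UnitaryColligation 𝔅)

theorem UnitaryColligation.prodU_apply (ξ : S.ℰ) (z : ℂ) :
    S.prodU (ξ, z) = WithLp.ofLp (S.U (WithLp.toLp 2 (ξ, z))) := rfl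

theorem UnitaryColligation.prodU_eq (ξ : S.ℰ) (z : ℂ) :
    S.prodU (ξ, z) = (S.A ξ + z • S.B, S.C ξ + S.D * z) := by
  have h : (ξ, z) = (ξ, (0 : ℂ)) + z • ((0 : S.ℰ), (1 : ℂ)) := by simp
  rw [h, map_add, map_smul]
  refine Prod.ext rfl ?_
  change S.C ξ + z * S.D = _
  rw [mul_comm]

theorem UnitaryColligation.norm_A_le : ‖S.A‖ ≤ 1 := by
  refine ContinuousLinearMap.opNorm_le_bound _ zero_le_one fun ξ => ?_
  have h1 : ‖S.U (WithLp.toLp 2 (ξ, 0))‖ = ‖ξ‖ := by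
    rw [LinearIsometryEquiv.norm_map, ← sq_eq_sq₀ (norm_nonneg _) (norm_nonneg _),
      WithLp.prod_norm_sq_eq_of_L2]
    simp
  have h2 : ‖S.A ξ‖ ^ 2 ≤ ‖ξ‖ ^ 2 := by
    rw [← h1, WithLp.prod_norm_sq_eq_of_L2]
    have : (S.U (WithLp.toLp 2 (ξ, 0))).fst = S.A ξ := rfl
    rw [this]
    have := sq_nonneg ‖(S.U (WithLp.toLp 2 (ξ, 0))).snd‖
    linarith
  rw [one_mul]
  exact le_of_sq_le_sq h2 (norm_nonneg _)

variable {G : Type u} [Semigroupoid G]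

theorem UnitaryColligation.isUnit_delta_sub (E : G → 𝔅) (hE : ∀ e, IsIdem e → ‖S.ρ (E e)‖ < 1)
    (e : G) (he : IsIdem e) :
    IsUnit ((fun y => deltaFun (S.ℰ →L[ℂ] S.ℰ) y - S.A * S.ρ (E y)) e) := by
  simp only [deltaFun_of_isIdem he]
  apply isUnit_one_sub_of_norm_lt_one
  calc ‖S.A * S.ρ (E e)‖ ≤ ‖S.A‖ * ‖S.ρ (E e)‖ := norm_mul_le _ _
    _ ≤ 1 * ‖S.ρ (E e)‖ := by gcongr; exact S.norm_A_le
    _ < 1 := by rw [one_mul]; exact hE e he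

/-- The first coordinate of the hypothesis reads `(δ - Aρ(E)) ⋆ L = Bδ`, which determines `L`; the
second coordinate then becomes the transfer formula. -/
theorem UnitaryColligation.eq_transfer (E : G → 𝔅) (hE : ∀ e, IsIdem e → ‖S.ρ (E e)‖ < 1)
    (L : G → S.ℰ) (φ : G → ℂ)
    (h : ∀ x, S.prodU (conv (fun y => S.ρ (E y)) L x, deltaFun ℂ x) = (L x, φ x)) :
    φ = S.transfer E := by
  have hinv := isStarInverse_starInv _ (S.isUnit_delta_sub E hE)
  have hL : conv (fun y => deltaFun (S.ℰ →L[ℂ] S.ℰ) y - S.A * S.ρ (E y)) L =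
      fun y => deltaFun ℂ y • S.B := by
    funext x
    have h1 := congrArg Prod.fst (h x)
    rw [S.prodU_eq] at h1
    dsimp only at h1
    have h2 : conv (fun y => deltaFun (S.ℰ →L[ℂ] S.ℰ) y - S.A * S.ρ (E y)) L x =
        conv (deltaFun (S.ℰ →L[ℂ] S.ℰ)) L x - S.A (conv (fun y => S.ρ (E y)) L x) := by
      simp only [conv, sub_smul, Finset.sum_sub_distrib, map_sum]
      rfl
    rw [h2, delta_conv, ← h1]
    simp
  funext x
  have h1 := congrArg Prod.snd (h x)
  rw [S.prodU_eq] at h1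
  dsimp only at h1
  rw [UnitaryColligation.transfer, ← h1, conv_assoc, ← hL, ← conv_assoc (starInv _), hinv.2,
    delta_conv, add_comm]

end Transfer

/-! ### Products with `[1]` and `[1] - EE*` -/

section KernelProducts

open PartialMul

variable {G : Type u} [Semigroupoid G]

/-- `[1]` is a left unit, because only factorizations with idempotent left factors survive. A
general `F` covers scalar multiplication and evaluation of functionals alike. -/
theorem sum_oneMat {A M : Type*} [Zero A] [One A] [AddCommMonoid M] (F : A → G → G → M)
    (hF : ∀ q s, F 0 q s = 0) (x y : G) :
    ∑ p ∈ factorPairs x, ∑ r ∈ factorPairs y, F (oneMat A p.1 r.1) p.2 r.2 = F 1 x y := by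
  rw [sum_factorPairs_of_left_idem, sum_factorPairs_of_left_idem]
  · simp [oneMat, isIdem_leftUnit]
  · intro r hr
    simp [oneMat, hr, hF]
  · intro p hp
    simp [oneMat, hp, hF]

theorem oneMat_eq_delta (x y : G) :
    (oneMat ℂ x y : ℂ) = deltaFun ℂ x * star (deltaFun ℂ y) := by
  classical
  by_cases hx : IsIdem x <;> by_cases hy : IsIdem y <;> simp [oneMat, deltaFun, hx, hy]

theorem khat_one_sub {𝔅 : Type*} [NormedRing 𝔅] [NormedSpace ℂ 𝔅] [Star 𝔅]
    (Γ : G → G → StrongDual ℂ 𝔅) (E : G → 𝔅) (x y : G) :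
    khat Γ (oneMat 𝔅 - outer E) x y = Γ x y 1 -
      ∑ p ∈ factorPairs x, ∑ r ∈ factorPairs y, Γ p.2 r.2 (E p.1 * star (E r.1)) := by
  rw [khat, ← sum_oneMat (fun b q s => Γ q s b) (by simp)]
  simp [outer, Finset.sum_sub_distrib]

end KernelProducts

/-! ### Direct sums of Hilbert spaces and representations -/

section DirectSum

variable {𝔅 : Type*} [NormedRing 𝔅] [NormedAlgebra ℂ 𝔅] [StarRing 𝔅]
variable {H₁ H₂ : Type*} [NormedAddCommGroup H₁] [InnerProductSpace ℂ H₁] [CompleteSpace H₁]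
  [NormedAddCommGroup H₂] [InnerProductSpace ℂ H₂] [CompleteSpace H₂]

/-- The direct sum of a representation and a multiple of a character. -/
noncomputable def repSumChar (ρ : 𝔅 →⋆ₐ[ℂ] (H₁ →L[ℂ] H₁)) (χ : 𝔅 →⋆ₐ[ℂ] ℂ) :
    𝔅 →⋆ₐ[ℂ] (WithLp 2 (H₁ × H₂) →L[ℂ] WithLp 2 (H₁ × H₂)) where
  toFun g := ((WithLp.prodContinuousLinearEquiv 2 ℂ H₁ H₂).symm : _ →L[ℂ] _) ∘L
    ((ρ g).prodMap (χ g • ContinuousLinearMap.id ℂ H₂)) ∘L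
    (WithLp.prodContinuousLinearEquiv 2 ℂ H₁ H₂ : _ →L[ℂ] _)
  map_one' := by
    ext x : 1
    simp
  map_zero' := by
    ext x : 1
    refine (WithLp.ext_iff ..).2 (Prod.ext ?_ ?_) <;> simp
  map_add' g g' := by
    ext x : 1
    refine (WithLp.ext_iff ..).2 (Prod.ext ?_ ?_) <;> simp [add_smul]
  map_mul' g g' := by
    ext x : 1
    refine (WithLp.ext_iff ..).2 (Prod.ext ?_ ?_) <;> simp [mul_smul]
  commutes' r := by
    ext x : 1
    refine (WithLp.ext_iff ..).2 (Prod.ext ?_ ?_) <;>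
      simp [Algebra.algebraMap_eq_smul_one]
  map_star' g := by
    refine (ContinuousLinearMap.eq_adjoint_iff _ _).mpr fun x y => ?_
    simp [WithLp.prod_inner_apply, map_star, ContinuousLinearMap.star_eq_adjoint,
      ContinuousLinearMap.adjoint_inner_left, inner_smul_left, inner_smul_right]

theorem repSumChar_apply (ρ : 𝔅 →⋆ₐ[ℂ] (H₁ →L[ℂ] H₁)) (χ : 𝔅 →⋆ₐ[ℂ] ℂ) (g : 𝔅) (ξ : H₁) (η : H₂) :
    repSumChar ρ χ g (WithLp.toLp 2 (ξ, η)) = WithLp.toLp 2 (ρ g ξ, χ g • η) := rfl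

/-- The embedding of the first summand of a direct sum. -/
noncomputable def sumInl (H₁ H₂ : Type*) [NormedAddCommGroup H₁] [InnerProductSpace ℂ H₁]
    [NormedAddCommGroup H₂] [InnerProductSpace ℂ H₂] : H₁ →ₗ[ℂ] WithLp 2 (H₁ × H₂) where
  toFun ξ := WithLp.toLp 2 (ξ, 0)
  map_add' a b := by
    refine (WithLp.ext_iff ..).2 (Prod.ext ?_ ?_) <;> simp
  map_smul' a b := by
    refine (WithLp.ext_iff ..).2 (Prod.ext ?_ ?_) <;> simp

/-- The isometry `(H₁ ⊕ H₂) ⊕ H₃ ≃ (H₁ ⊕ H₃) ⊕ H₂`. -/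
noncomputable def sumSwap (H₁ H₂ H₃ : Type*) [NormedAddCommGroup H₁] [InnerProductSpace ℂ H₁]
    [NormedAddCommGroup H₂] [InnerProductSpace ℂ H₂] [NormedAddCommGroup H₃]
    [InnerProductSpace ℂ H₃] :
    WithLp 2 (WithLp 2 (H₁ × H₂) × H₃) ≃ₗᵢ[ℂ] WithLp 2 (WithLp 2 (H₁ × H₃) × H₂) where
  toFun p := WithLp.toLp 2 (WithLp.toLp 2 (p.fst.fst, p.snd), p.fst.snd)
  invFun p := WithLp.toLp 2 (WithLp.toLp 2 (p.fst.fst, p.snd), p.fst.snd)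
  left_inv _ := rfl
  right_inv _ := rfl
  map_add' _ _ := rfl
  map_smul' _ _ := rfl
  norm_map' p := by
    change ‖WithLp.toLp 2 (WithLp.toLp 2 (p.fst.fst, p.snd), p.fst.snd)‖ = ‖p‖
    rw [← sq_eq_sq₀ (norm_nonneg _) (norm_nonneg _), WithLp.prod_norm_sq_eq_of_L2,
      WithLp.prod_norm_sq_eq_of_L2, WithLp.prod_norm_sq_eq_of_L2, WithLp.prod_norm_sq_eq_of_L2]
    simp only [WithLp.toLp_fst, WithLp.toLp_snd]
    ring

end DirectSum

/-! ### The lurking isometry -/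

section Realization

open PartialMul

variable {G : Type u} [Semigroupoid G]

/-- Evaluation at a point as a character. -/
noncomputable def evalChar {Y : Type*} [TopologicalSpace Y] (y : Y) : (Y →ᵇ ℂ) →⋆ₐ[ℂ] ℂ where
  toFun g := g y
  map_one' := rfl
  map_mul' _ _ := rfl
  map_zero' := rfl
  map_add' _ _ := rfl
  commutes' _ := rfl
  map_star' _ := rfl

theorem norm_starAlgHom_le {Y : Type*} [TopologicalSpace Y] {H : Type*} [NormedAddCommGroup H]
    [InnerProductSpace ℂ H] [CompleteSpace H] (ρ : (Y →ᵇ ℂ) →⋆ₐ[ℂ] (H →L[ℂ] H)) (g : Y →ᵇ ℂ) :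
    ‖ρ g‖ ≤ ‖g‖ := NonUnitalStarAlgHom.norm_apply_le ρ g

/-- Uniform convergence provides one `n > 0` with `|ψ(e)|ⁿ ≤ 1/2` for all `ψ`, hence the uniform
bound `(1/2)^(1/n) < 1`. -/
theorem IsTestFamily.norm_evalMap_lt {Ψ : Set (G → ℂ)} (hΨ : IsTestFamily Ψ) {e : G}
    (he : IsIdem e) : ‖evalMap hΨ e‖ < 1 := by
  have h := Metric.tendstoUniformlyOn_iff.1 (hΨ.tendsto_zero e he).2 (1 / 2) (by norm_num)
  obtain ⟨n, hn, hn0⟩ := (h.and (Filter.eventually_gt_atTop 0)).exists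
  have hb : ∀ ψ ∈ Ψ, ‖ψ e‖ ≤ (1 / 2 : ℝ) ^ ((n : ℝ)⁻¹) := by
    intro ψ hψ
    have h1 := (hn ψ hψ).le
    rw [dist_zero_left, norm_pow] at h1
    rw [← Real.pow_rpow_inv_natCast (norm_nonneg (ψ e)) hn0.ne']
    exact Real.rpow_le_rpow (by positivity) h1 (by positivity)
  have h2 : (1 / 2 : ℝ) ^ ((n : ℝ)⁻¹) < 1 :=
    Real.rpow_lt_one (by norm_num) (by norm_num) (by positivity)
  refine lt_of_le_of_lt ?_ h2
  rw [BoundedContinuousFunction.norm_le (by positivity)]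
  exact fun ψ => hb ψ.1 ψ.2

/-- The lurking isometry argument. -/
theorem exists_colligation {Y : Type u} [TopologicalSpace Y] (y₀ : Y) (E : G → (Y →ᵇ ℂ))
    (hE : ∀ e, IsIdem e → ‖E e‖ < 1) (φ : G → ℂ) (Γ : G → G → StrongDual ℂ (Y →ᵇ ℂ))
    (hΓ : IsPosDualKernel Γ)
    (h : ∀ x y : G, (oneMat ℂ - outer φ : G → G → ℂ) x y = khat Γ (oneMat (Y →ᵇ ℂ) - outer E) x y) :
    ∃ S : UnitaryColligation (Y →ᵇ ℂ), φ = S.transfer E := by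
  obtain ⟨ℰ, _, _, _, ρ, L, hL⟩ := exists_kolmogorov hΓ
  let W : G → ℰ := fun x => ∑ p ∈ factorPairs x, ρ (E p.1) (L p.2)
  let u : G → WithLp 2 (ℰ × ℂ) := fun x => WithLp.toLp 2 (W x, deltaFun ℂ x)
  let v : G → WithLp 2 (ℰ × ℂ) := fun x => WithLp.toLp 2 (L x, φ x)
  -- The kernel identity with its negative terms moved across: `δδ* + ⟨W, W⟩ = φφ* + ⟨L, L⟩`.
  have huv : ∀ y x, inner ℂ (u y) (u x) = inner ℂ (v y) (v x) := by
    intro y x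
    have h1 := h x y
    rw [khat_one_sub] at h1
    have h2 : ∑ p ∈ factorPairs x, ∑ r ∈ factorPairs y, Γ p.2 r.2 (E p.1 * star (E r.1)) =
        inner ℂ (W y) (W x) := by
      simp only [W, inner_sum, sum_inner]
      refine Finset.sum_congr rfl fun p _ => Finset.sum_congr rfl fun r _ => ?_
      rw [hL, mul_comm, map_mul, map_star, ContinuousLinearMap.star_eq_adjoint,
        mul_apply_eq_comp, ContinuousLinearMap.adjoint_inner_right]
    rw [h2, hL, map_one, one_apply_eq_self] at h1
    simp only [Pi.sub_apply, oneMat_eq_delta, outer] at h1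
    simp only [u, v, WithLp.prod_inner_apply, RCLike.inner_apply]
    simp only [RCLike.star_def] at h1
    linear_combination h1
  obtain ⟨U, hU⟩ := exists_unitary_extension u v huv
  -- The dilation acts on `(ℰ ⊕ ℂ) ⊕ K` with `K = ℰ ⊕ ℂ`. Regrouping puts `K` into the state space.
  -- There any unital representation will do, as the vectors `L x` have no component in `K`;
  -- evaluation at `y₀` supplies one.
  let e := sumSwap ℰ (WithLp 2 (ℰ × ℂ)) ℂ
  let S : UnitaryColligation (Y →ᵇ ℂ) :=
    { ℰ := WithLp 2 (ℰ × WithLp 2 (ℰ × ℂ))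
      U := (e.trans U).trans e.symm
      ρ := repSumChar ρ (evalChar y₀) }
  refine ⟨S, S.eq_transfer E (fun x hx => (norm_starAlgHom_le S.ρ _).trans_lt (hE x hx))
    (fun x => WithLp.toLp 2 (L x, 0)) φ fun x => ?_⟩
  have hconv : conv (fun y => S.ρ (E y)) (fun x => (WithLp.toLp 2 (L x, 0) : S.ℰ)) x =
      WithLp.toLp 2 (W x, 0) := by
    have h1 : ∀ p : G × G, S.ρ (E p.1) • (WithLp.toLp 2 (L p.2, 0) : S.ℰ) =
        WithLp.toLp 2 (ρ (E p.1) (L p.2), 0) := by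
      intro p
      refine (repSumChar_apply ρ (evalChar y₀) (E p.1) (L p.2) 0).trans ?_
      rw [smul_zero]
    simp only [conv, h1]
    exact (map_sum (sumInl ℰ (WithLp 2 (ℰ × ℂ))) _ _).symm
  rw [hconv, S.prodU_apply]
  have h2 : S.U (WithLp.toLp 2 (WithLp.toLp 2 (W x, 0), deltaFun ℂ x)) =
      e.symm (U (WithLp.toLp 2 (u x, 0))) := rfl
  rw [h2, hU]
  rfl

end Realization

/-! ### Bounds and weak-* limits of positive kernels -/

section Compactness

theorem extendKernel_apply {G : Type u} {F : Finset G} {A : Type*} [Zero A] (Γ : F → F → A) (x y : F) :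
    extendKernel Γ x y = Γ x y := by
  simp [extendKernel, extendZero]

theorem extendKernel_of_notMem {G : Type u} {F : Finset G} {A : Type*} [Zero A] (Γ : F → F → A) (x y : G)
    (h : ¬ (x ∈ F ∧ y ∈ F)) : extendKernel Γ x y = 0 := by
  by_cases hx : x ∈ F
  · have hy : y ∉ F := fun hy => h ⟨hx, hy⟩
    simp [extendKernel, extendZero, hy]
  · simp [extendKernel, extendZero, hx]

open PartialMul Filter Topology

variable {G : Type u} [Semigroupoid G] {Y : Type u} [TopologicalSpace Y]

/-- For the Kolmogorov vectors, `‖L x‖² ≤ B x + ‖W x‖²` with `W = ρ(E) ⋆ L`. Splitting off the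
diagonal term of `W x` gives `‖L x‖ ≤ √(B x) + ‖E e‖ ‖L x‖ + ∑ c(q)`, where `e = leftUnit x` and `q`
runs over proper right factors. As `‖E e‖ < 1`, this can be solved for `‖L x‖`, with a bound `c`
independent of `Γ`. -/
theorem exists_kernel_bound (E : G → (Y →ᵇ ℂ)) (hE1 : ∀ x, ‖E x‖ ≤ 1)
    (hE : ∀ e, IsIdem e → ‖E e‖ < 1) (B : G → ℝ) :
    ∃ c : G → ℝ, ∀ (Γ : G → G → StrongDual ℂ (Y →ᵇ ℂ)), IsPosDualKernel Γ →
      ∀ x y, (∀ z, Precedes z x ∨ Precedes z y →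
        ‖khat Γ (oneMat (Y →ᵇ ℂ) - outer E) z z‖ ≤ B z) → ∀ g, ‖Γ x y g‖ ≤ c x * c y * ‖g‖ := by
  obtain ⟨c, hc⟩ := exists_leftLt_rec (fun (x : G) (c : G → ℝ) =>
    (√(B x) + ∑ p ∈ properPairs x, c p.2) / (1 - ‖E (leftUnit x)‖)) (by
      intro x g g' h
      rw [Finset.sum_congr rfl fun p hp => h _ (leftLt_of_mem_properPairs hp)])
  refine ⟨c, fun Γ hΓ => ?_⟩
  obtain ⟨ℰ, _, _, _, ρ, L, hL⟩ := exists_kolmogorov hΓ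
  have key : ∀ x, (∀ z, Precedes z x → ‖khat Γ (oneMat (Y →ᵇ ℂ) - outer E) z z‖ ≤ B z) →
      ‖L x‖ ≤ c x := by
    refine fun x => wellFounded_leftLt.induction (C := fun x => (∀ z, Precedes z x →
      ‖khat Γ (oneMat (Y →ᵇ ℂ) - outer E) z z‖ ≤ B z) → ‖L x‖ ≤ c x) x ?_
    · intro x ih hB
      let W : ℰ := ∑ p ∈ factorPairs x, ρ (E p.1) (L p.2)
      have hW : ∑ p ∈ factorPairs x, ∑ r ∈ factorPairs x, Γ p.2 r.2 (E p.1 * star (E r.1)) =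
          inner ℂ W W := by
        simp only [W, inner_sum, sum_inner]
        refine Finset.sum_congr rfl fun p _ => Finset.sum_congr rfl fun r _ => ?_
        rw [hL, mul_comm, map_mul, map_star, ContinuousLinearMap.star_eq_adjoint,
          mul_apply_eq_comp, ContinuousLinearMap.adjoint_inner_right]
      have h1 := khat_one_sub Γ E x x
      rw [hW, hL, map_one, one_apply_eq_self, inner_self_eq_norm_sq_to_K,
        inner_self_eq_norm_sq_to_K] at h1
      have h2 := hB x (precedes_refl x)
      have h3 : ‖L x‖ ^ 2 ≤ B x + ‖W‖ ^ 2 := by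
        have h4 := (Complex.re_le_norm _).trans h2
        rw [h1] at h4
        have h5 : ((((‖L x‖ : ℝ) : ℂ)) ^ 2 - ((‖W‖ : ℝ) : ℂ) ^ 2).re = ‖L x‖ ^ 2 - ‖W‖ ^ 2 := by
          rw [← Complex.ofReal_pow, ← Complex.ofReal_pow, ← Complex.ofReal_sub, Complex.ofReal_re]
        have h6 : ‖L x‖ ^ 2 - ‖W‖ ^ 2 ≤ B x := h5 ▸ h4
        linarith
      have hB0 : 0 ≤ B x := (norm_nonneg _).trans h2
      have h4 : ‖L x‖ ≤ √(B x) + ‖W‖ := by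
        refine le_of_sq_le_sq (h3.trans ?_) (by positivity)
        have := Real.sq_sqrt hB0
        have := mul_nonneg (Real.sqrt_nonneg (B x)) (norm_nonneg W)
        nlinarith
      have h5 : ‖W‖ ≤ ‖E (leftUnit x)‖ * ‖L x‖ + ∑ p ∈ properPairs x, c p.2 := by
        have : W = ρ (E (leftUnit x)) (L x) + ∑ p ∈ properPairs x, ρ (E p.1) (L p.2) :=
          sum_factorPairs_split x _
        rw [this]
        refine (norm_add_le _ _).trans (add_le_add ?_ ?_)
        · refine (ContinuousLinearMap.le_opNorm _ _).trans ?_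
          gcongr
          exact norm_starAlgHom_le ρ _
        · refine (norm_sum_le _ _).trans (Finset.sum_le_sum fun p hp => ?_)
          have hlt := leftLt_of_mem_properPairs hp
          refine (ContinuousLinearMap.le_opNorm _ _).trans ?_
          have h6 := ih p.2 hlt fun z hz => hB z (precedes_trans hz hlt.precedes)
          have h7 := (norm_starAlgHom_le ρ (E p.1)).trans (hE1 p.1)
          calc _ ≤ 1 * ‖L p.2‖ := by gcongr
            _ ≤ c p.2 := by rwa [one_mul]
      rw [hc, le_div_iff₀ (by have := hE _ (isIdem_leftUnit x); linarith)]
      linarith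
  intro x y hB g
  have hx := key x fun z hz => hB z (Or.inl hz)
  have hy := key y fun z hz => hB z (Or.inr hz)
  rw [hL]
  calc _ ≤ ‖L y‖ * ‖ρ g (L x)‖ := norm_inner_le_norm _ _
    _ ≤ ‖L y‖ * (‖ρ g‖ * ‖L x‖) := by gcongr; exact ContinuousLinearMap.le_opNorm _ _
    _ ≤ c y * (‖g‖ * c x) := by
      have := norm_starAlgHom_le ρ g
      have := (norm_nonneg _).trans hy
      gcongr
    _ = _ := by ring

/-- Banach–Alaoglu: closed balls of the dual are weak-* compact, so a bounded ultrafilter converges.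
-/
theorem exists_weakStar_limit {V ι : Type*} [NormedAddCommGroup V] [NormedSpace ℂ V]
    (𝒰 : Ultrafilter ι) (T : ι → StrongDual ℂ V) (C : ℝ) (hC : 0 ≤ C)
    (hT : ∀ᶠ i in 𝒰, ∀ g, ‖T i g‖ ≤ C * ‖g‖) :
    ∃ T₀ : StrongDual ℂ V, ∀ g, Tendsto (fun i => T i g) 𝒰 (𝓝 (T₀ g)) := by
  have hc := WeakDual.isCompact_closedBall (0 : StrongDual ℂ V) C
  obtain ⟨a, -, ha⟩ := hc.ultrafilter_le_nhds' (𝒰.map fun i => StrongDual.toWeakDual (T i)) (by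
    change ∀ᶠ i in (𝒰 : Filter ι), _
    filter_upwards [hT] with i hi
    simp only [Set.mem_preimage, Metric.mem_closedBall, dist_zero_right]
    exact ContinuousLinearMap.opNorm_le_bound _ hC hi)
  refine ⟨WeakDual.toStrongDual a, fun g => ?_⟩
  exact ((WeakDual.eval_continuous g).tendsto a).comp ha

theorem sum_sum_filter {X M : Type*} [AddCommMonoid M] (F : Set X) [DecidablePred (· ∈ F)]
    (A : Finset X) (f : X → X → M) (hf : ∀ x y, ¬ (x ∈ F ∧ y ∈ F) → f x y = 0) :
    ∑ x ∈ A, ∑ y ∈ A, f x y =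
      ∑ x ∈ A.filter (· ∈ F), ∑ y ∈ A.filter (· ∈ F), f x y := by
  rw [Finset.sum_filter]
  refine Finset.sum_congr rfl fun x _ => ?_
  split_ifs with hx
  · rw [Finset.sum_filter]
    refine Finset.sum_congr rfl fun y _ => ?_
    split_ifs with hy
    · rfl
    · exact hf x y fun h => hy h.2
  · exact Finset.sum_eq_zero fun y _ => hf x y fun h => hx h.1

/-- A limit of products of positive kernels with `[1] - EE*` is again such a product. -/
theorem exists_posDualKernel_of_tendsto (E : G → (Y →ᵇ ℂ)) (hE1 : ∀ x, ‖E x‖ ≤ 1)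
    (hE : ∀ e, IsIdem e → ‖E e‖ < 1) (F : Set G) (hF : IsLower F) {ι : Type*} (l : Filter ι)
    [l.NeBot] (Γ : ι → G → G → StrongDual ℂ (Y →ᵇ ℂ)) (hΓ : ∀ i, IsPosDualKernel (Γ i))
    (P : G → G → ℂ) (hP : ∀ x ∈ F, ∀ y ∈ F,
      Tendsto (fun i => khat (Γ i) (oneMat (Y →ᵇ ℂ) - outer E) x y) l (𝓝 (P x y))) :
    ∃ Γ₀ : G → G → StrongDual ℂ (Y →ᵇ ℂ), IsPosDualKernel Γ₀ ∧
      ∀ x ∈ F, ∀ y ∈ F, P x y = khat Γ₀ (oneMat (Y →ᵇ ℂ) - outer E) x y := by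
  classical
  obtain ⟨c, hc⟩ := exists_kernel_bound E hE1 hE fun x => ‖P x x‖ + 1
  let 𝒰 := Ultrafilter.of l
  have hle : (𝒰 : Filter ι) ≤ l := Ultrafilter.of_le l
  -- Only finitely many elements precede `x`, so convergence of the diagonal entries bounds all of
  -- them at once by `‖P z z‖ + 1`.
  have hB : ∀ x ∈ F, ∀ᶠ i in l, ∀ z, Precedes z x →
      ‖khat (Γ i) (oneMat (Y →ᵇ ℂ) - outer E) z z‖ ≤ ‖P z z‖ + 1 := by
    intro x hx
    have := (eventually_all_finite (l := l) (finite_precedes x) (p := fun z i =>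
      ‖khat (Γ i) (oneMat (Y →ᵇ ℂ) - outer E) z z‖ ≤ ‖P z z‖ + 1)).2 (fun z hz =>
        ((hP z (hF x hx z hz) z (hF x hx z hz)).norm.eventually_le_const (lt_add_one _)))
    exact this
  have hlim : ∀ x y, ∃ T : StrongDual ℂ (Y →ᵇ ℂ), (¬ (x ∈ F ∧ y ∈ F) → T = 0) ∧
      (x ∈ F ∧ y ∈ F → ∀ g, Tendsto (fun i => Γ i x y g) 𝒰 (𝓝 (T g))) := by
    intro x y
    by_cases hxy : x ∈ F ∧ y ∈ F
    · have hev : ∀ᶠ i in 𝒰, ∀ g, ‖Γ i x y g‖ ≤ max (c x * c y) 0 * ‖g‖ := by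
        filter_upwards [hle (hB x hxy.1), hle (hB y hxy.2)] with i h1 h2 g
        refine (hc (Γ i) (hΓ i) x y ?_ g).trans ?_
        · rintro z (hz | hz)
          exacts [h1 z hz, h2 z hz]
        · gcongr
          exact le_max_left _ _
      obtain ⟨T, hT⟩ := exists_weakStar_limit 𝒰 (fun i => Γ i x y) _ (le_max_right _ _) hev
      exact ⟨T, fun h => absurd hxy h, fun _ => hT⟩
    · exact ⟨0, fun _ => rfl, fun h => absurd h hxy⟩
  choose Γ₀ hΓ0 hΓl using hlim
  refine ⟨Γ₀, ?_, ?_⟩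
  · intro A f
    rw [sum_sum_filter F A (fun x y => Γ₀ x y (f x * star (f y)))
      (fun x y h => by rw [hΓ0 x y h]; rfl)]
    refine ge_of_tendsto' (tendsto_finsetSum _ fun x hx => tendsto_finsetSum _ fun y hy =>
      hΓl x y ⟨(Finset.mem_filter.1 hx).2, (Finset.mem_filter.1 hy).2⟩ _) fun i => ?_
    exact hΓ i _ f
  · intro x hx y hy
    -- Each entry of the product is a finite sum of evaluations at right factors, which stay in the
    -- lower set `F`, so it passes to the limit.
    refine tendsto_nhds_unique ((hP x hx y hy).mono_left hle) ?_
    refine tendsto_finsetSum _ fun p hp => tendsto_finsetSum _ fun r hr => hΓl _ _ ⟨?_, ?_⟩ _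
    · exact hF x hx _ ⟨p.1, rightUnit x, by simp [pmul₃, mem_factorPairs.1 hp, pmul_rightUnit]⟩
    · exact hF y hy _ ⟨r.1, rightUnit y, by simp [pmul₃, mem_factorPairs.1 hr, pmul_rightUnit]⟩

theorem IsPosDualKernel.extendKernel {G : Type u} {F : Finset G} {𝔅 : Type*} [NormedRing 𝔅] [StarRing 𝔅]
    [NormedSpace ℂ 𝔅] {Γ : F → F → StrongDual ℂ 𝔅} (hΓ : IsPosDualKernel Γ) :
    IsPosDualKernel (extendKernel Γ) := by
  classical
  intro A f
  rw [sum_sum_filter (F : Set G) A (fun x y => _root_.extendKernel Γ x y (f x * star (f y)))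
      (fun x y h => by rw [extendKernel_of_notMem Γ x y (by simpa using h)]; rfl)]
  have h := hΓ (A.subtype (· ∈ F)) fun x => f x
  simp only [Finset.mem_coe]
  rw [← Finset.sum_subtype_eq_sum_filter]
  simp only [← Finset.sum_subtype_eq_sum_filter (p := (· ∈ F))]
  simpa only [extendKernel_apply] using h

theorem IsPosDualKernel.restrict {X Z 𝔅 : Type*} [NormedRing 𝔅] [StarRing 𝔅]
    [NormedSpace ℂ 𝔅] {Γ : X → X → StrongDual ℂ 𝔅} (hΓ : IsPosDualKernel Γ) (i : Z ↪ X) :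
    IsPosDualKernel fun x y => Γ (i x) (i y) := by
  classical
  intro A f
  rcases isEmpty_or_nonempty Z with hZ | hZ
  · simp [Finset.eq_empty_of_isEmpty A]
  have h := hΓ (A.map i) (f ∘ Function.invFun i)
  simpa [Finset.sum_map, Function.leftInverse_invFun i.injective _] using h

theorem khat_congr {𝔅 : Type*} [NormedAddCommGroup 𝔅] [NormedSpace ℂ 𝔅] {F : Set G}
    (hF : IsLower F) {Γ Γ' : G → G → StrongDual ℂ 𝔅} (h : ∀ x ∈ F, ∀ y ∈ F, Γ x y = Γ' x y)
    (M : G → G → 𝔅) {x y : G} (hx : x ∈ F) (hy : y ∈ F) : khat Γ M x y = khat Γ' M x y := by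
  refine Finset.sum_congr rfl fun p hp => Finset.sum_congr rfl fun r hr => ?_
  rw [h]
  · exact hF x hx _ ⟨p.1, rightUnit x, by simp [pmul₃, mem_factorPairs.1 hp, pmul_rightUnit]⟩
  · exact hF y hy _ ⟨r.1, rightUnit y, by simp [pmul₃, mem_factorPairs.1 hr, pmul_rightUnit]⟩

/-- The finite lower set generated by a finite set. -/
theorem exists_finite_lower (A : Finset G) : ∃ F : Finset G, IsLower (F : Set G) ∧ A ⊆ F := by
  classical
  refine ⟨A.biUnion fun a => (finite_precedes a).toFinset, ?_, ?_⟩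
  · intro a ha b hb
    simp only [Finset.coe_biUnion, Set.Finite.coe_toFinset, Set.mem_iUnion, Set.mem_ofPred_eq,
      Finset.mem_coe] at ha ⊢
    obtain ⟨c, hc, hac⟩ := ha
    exact ⟨c, hc, precedes_trans hb hac⟩
  · intro a ha
    simp only [Finset.mem_biUnion, Set.Finite.mem_toFinset, Set.mem_ofPred_eq]
    exact ⟨a, ha, precedes_refl a⟩

/-- Extended by zero, the local kernels are indexed by the finite sets `A`. At a given pair the
identity holds as soon as `A` contains both points, so the limit kernel satisfies it everywhere. -/
theorem exists_global_kernel (E : G → (Y →ᵇ ℂ)) (hE1 : ∀ x, ‖E x‖ ≤ 1)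
    (hE : ∀ e, IsIdem e → ‖E e‖ < 1) (P : G → G → ℂ)
    (h : ∀ F : Finset G, IsLower (F : Set G) →
        ∃ Γ : F → F → StrongDual ℂ (Y →ᵇ ℂ), IsPosDualKernel Γ ∧
          ∀ x y : F, P x y = khat (extendKernel Γ) (oneMat (Y →ᵇ ℂ) - outer E) x y) :
    ∃ Γ : G → G → StrongDual ℂ (Y →ᵇ ℂ), IsPosDualKernel Γ ∧
      ∀ x y : G, P x y = khat Γ (oneMat (Y →ᵇ ℂ) - outer E) x y := by
  choose F hF hAF using exists_finite_lower (G := G)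
  choose Γ hΓ hP using fun A => h (F A) (hF A)
  obtain ⟨Γ₀, h0, h1⟩ := exists_posDualKernel_of_tendsto E hE1 hE Set.univ
    (fun _ _ _ _ => Set.mem_univ _) (atTop : Filter (Finset G)) (fun A => extendKernel (Γ A))
    (fun A => (hΓ A).extendKernel) P (by
      classical
      intro x _ y _
      refine tendsto_const_nhds.congr' ?_
      filter_upwards [eventually_ge_atTop {x, y}] with A hA
      have hx : x ∈ F A := hAF A (hA (by simp))
      have hy : y ∈ F A := hAF A (hA (by simp))
      exact hP A ⟨x, hx⟩ ⟨y, hy⟩)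
  exact ⟨Γ₀, h0, fun x y => h1 x trivial y trivial⟩

end Compactness

/-! ### Square roots of positive matrices over `C_b(Y)` -/

section SquareRoot

open scoped Matrix.Norms.L2Operator MatrixOrder

variable {Y : Type*} [TopologicalSpace Y]

/-- A pointwise positive matrix of bounded continuous functions is of the form `S S*`. -/
theorem exists_matrix_factorization {X : Type*} [Fintype X] (N : X → X → (Y →ᵇ ℂ))
    (hN : ∀ y, (Matrix.of fun i j => N i j y).PosSemidef) :
    ∃ s : X → X → (Y →ᵇ ℂ), ∀ i j, N i j = ∑ l, s i l * star (s j l) := by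
  classical
  let T : Y → Matrix X X ℂ := fun y => Matrix.of fun i j => N i j y
  have hTc : Continuous T := continuous_matrix fun i j => (N i j).continuous
  have hT0 : ∀ y, 0 ≤ T y := fun y => Matrix.nonneg_iff_posSemidef.2 (hN y)
  let R : Y → Matrix X X ℂ := fun y => CFC.sqrt (T y)
  have hRc : Continuous R := CFC.continuousOn_sqrt.comp_continuous hTc hT0
  have hRR : ∀ y, R y * star (R y) = T y := by
    intro y
    have h : IsSelfAdjoint (R y) := IsSelfAdjoint.of_nonneg (CFC.sqrt_nonneg (T y))
    rw [h.star_eq]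
    exact CFC.sqrt_mul_sqrt_self (T y) (hT0 y)
  have hent : ∀ y i j, N i j y = ∑ l, R y i l * star (R y j l) := by
    intro y i j
    have := congrFun (congrFun (hRR y) i) j
    rw [Matrix.mul_apply] at this
    exact this.symm
  -- The diagonal of `RR* = T` gives `∑ |R i l|² = N i i`, which bounds each entry uniformly in `y`.
  have hbd : ∀ y i l, ‖R y i l‖ ≤ √‖N i i‖ := by
    intro y i l
    refine Real.le_sqrt_of_sq_le ?_
    have h1 := hent y i i
    have h2 : ∑ l, R y i l * star (R y i l) = ((∑ l, ‖R y i l‖ ^ 2 : ℝ) : ℂ) := by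
      push_cast
      refine Finset.sum_congr rfl fun l _ => ?_
      rw [RCLike.star_def, Complex.mul_conj, Complex.normSq_eq_norm_sq]
      push_cast
      rfl
    rw [h2] at h1
    have h3 := (N i i).norm_coe_le_norm y
    rw [h1, Complex.norm_real, Real.norm_of_nonneg (by positivity)] at h3
    exact (Finset.single_le_sum (f := fun l => ‖R y i l‖ ^ 2) (fun _ _ => by positivity)
      (Finset.mem_univ l)).trans h3
  refine ⟨fun i l => BoundedContinuousFunction.ofNormedAddCommGroup (fun y => R y i l)
    (hRc.matrix_elem i l) _ fun y => hbd y i l, fun i j => ?_⟩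
  ext y
  rw [hent]
  simp [BoundedContinuousFunction.sum_apply]

end SquareRoot

/-! ### Transfer functions satisfy the norm bound -/

section TransferPositive

open PartialMul

variable {G : Type u} [Semigroupoid G]

theorem kconv_one_smul_sub (c : ℂ) (φ : G → ℂ) (k : G → G → ℂ) (x y : G) :
    kconv (c • oneMat ℂ - outer φ) k x y = c * k x y -
      ∑ p ∈ factorPairs x, ∑ r ∈ factorPairs y, φ p.1 * star (φ r.1) * k p.2 r.2 := by
  have h := sum_oneMat (G := G) (fun (b : ℂ) q s => b * (c * k q s)) (by simp) x y
  rw [one_mul] at h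
  rw [← h, kconv]
  simp only [← Finset.sum_sub_distrib]
  refine Finset.sum_congr rfl fun p _ => Finset.sum_congr rfl fun r _ => ?_
  simp [outer]
  ring

/-- The associative law applied in both variables of a kernel product at once. -/
theorem sum_kernel_assoc {M : Type*} [AddCommMonoid M] (F : G → G → G → G → G → G → M) (a b : G) :
    ∑ p ∈ factorPairs a, ∑ r ∈ factorPairs b, ∑ u ∈ factorPairs p.1, ∑ v ∈ factorPairs r.1,
      F u.1 v.1 u.2 v.2 p.2 r.2 =
    ∑ p ∈ factorPairs a, ∑ r ∈ factorPairs b, ∑ u ∈ factorPairs p.2, ∑ v ∈ factorPairs r.2,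
      F p.1 r.1 u.1 v.1 u.2 v.2 := by
  calc _ = ∑ p ∈ factorPairs a, ∑ u ∈ factorPairs p.1, ∑ r ∈ factorPairs b,
        ∑ v ∈ factorPairs r.1, F u.1 v.1 u.2 v.2 p.2 r.2 :=
        Finset.sum_congr rfl fun p _ => Finset.sum_comm
    _ = ∑ p ∈ factorPairs a, ∑ u ∈ factorPairs p.2, ∑ r ∈ factorPairs b,
        ∑ v ∈ factorPairs r.1, F p.1 v.1 u.1 v.2 u.2 r.2 :=
        sum_factorPairs_assoc a fun x y z => ∑ r ∈ factorPairs b,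
          ∑ v ∈ factorPairs r.1, F x v.1 y v.2 z r.2
    _ = ∑ p ∈ factorPairs a, ∑ u ∈ factorPairs p.2, ∑ r ∈ factorPairs b,
        ∑ v ∈ factorPairs r.2, F p.1 r.1 u.1 v.1 u.2 v.2 :=
        Finset.sum_congr rfl fun p _ => Finset.sum_congr rfl fun u _ =>
          sum_factorPairs_assoc b fun x y z => F p.1 x u.1 y u.2 z
    _ = _ := Finset.sum_congr rfl fun p _ => Finset.sum_comm

/-- The dual form of the transfer function: `[1] - WW* = Γ' ⋆ ([1] - EE*)`. -/
theorem UnitaryColligation.exists_left_vectors {Y : Type u} [TopologicalSpace Y]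
    (S : UnitaryColligation (Y →ᵇ ℂ)) (E : G → (Y →ᵇ ℂ))
    (hE : ∀ e, IsIdem e → ‖S.ρ (E e)‖ < 1) :
    ∃ r : G → S.ℰ, ∀ x y, (oneMat ℂ - outer (S.transfer E) : G → G → ℂ) x y =
      ∑ p ∈ factorPairs x, ∑ v ∈ factorPairs y, inner ℂ (r p.1)
        (S.ρ ((oneMat (Y →ᵇ ℂ) - outer E : G → G → (Y →ᵇ ℂ)) p.2 v.2) (r v.1)) := by
  set Z : G → (S.ℰ →L[ℂ] S.ℰ) := fun y => S.ρ (E y) with hZ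
  have hinv := isStarInverse_starInv _ (S.isUnit_delta_sub E hE)
  set g := starInv (fun y => deltaFun (S.ℰ →L[ℂ] S.ℰ) y - S.A * S.ρ (E y)) with hg
  set H := conv Z g with hH
  -- With `Z = ρ(E)` and `g = (δ - AZ)⁻¹`, the function `h = δ + (Z ⋆ g)A` satisfies `Z ⋆ g = h ⋆
  -- Z`. This moves `Z` from the left of the resolvent to the right.
  let h : G → (S.ℰ →L[ℂ] S.ℰ) := fun x => deltaFun (S.ℰ →L[ℂ] S.ℰ) x + H x * S.A
  have hg' : g = deltaFun (S.ℰ →L[ℂ] S.ℰ) + conv g (fun y => S.A * Z y) := by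
    rw [← hinv.2]
    funext x
    simp only [conv, Pi.add_apply, ← Finset.sum_add_distrib, ← smul_add]
    simp only [hZ, sub_add_cancel]
    exact (congrFun (conv_delta g) x).symm
  have hHh : H = conv h Z := by
    have h1 : conv h Z = Z + conv (fun x => H x * S.A) Z := by
      have := delta_conv (A := S.ℰ →L[ℂ] S.ℰ) Z
      funext x
      rw [Pi.add_apply]
      nth_rewrite 2 [← this]
      simp only [conv, h, ← Finset.sum_add_distrib, add_smul]
    have h2 : conv (fun x => H x * S.A) Z = conv H (fun y => S.A * Z y) := by
      funext x
      simp only [conv, smul_eq_mul, mul_assoc]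
    rw [h1, h2, hH, conv_assoc]
    nth_rewrite 1 [hg']
    funext x
    have := congrFun (conv_delta Z) x
    rw [Pi.add_apply, ← this]
    simp only [conv, Pi.add_apply, smul_add, Finset.sum_add_distrib]
  let c : S.ℰ := S.C.adjoint 1
  have hc : ∀ ξ, inner ℂ c ξ = S.C ξ := by
    intro ξ
    rw [ContinuousLinearMap.adjoint_inner_left]
    simp
  let r : G → S.ℰ := fun x => (h x).adjoint c
  let w : G → S.ℰ := fun x => (H x).adjoint c
  have hw : ∀ x, w x = ∑ p ∈ factorPairs x, (Z p.2).adjoint (r p.1) := by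
    intro x
    simp only [w]
    rw [hHh]
    simp only [conv, map_sum, _root_.sum_apply, smul_eq_mul, r]
    refine Finset.sum_congr rfl fun p _ => ?_
    rw [ContinuousLinearMap.mul_def, ContinuousLinearMap.adjoint_comp]
    rfl
  have hW : ∀ x, S.transfer E x = S.D * deltaFun ℂ x + S.C (H x S.B) := by
    intro x
    rw [UnitaryColligation.transfer]
    change _ + S.C (conv H (fun y => deltaFun ℂ y • S.B) x) = _
    rw [conv, sum_factorPairs_of_right_idem]
    · simp [deltaFun_of_isIdem (isIdem_rightUnit x)]
    · intro p hp
      simp [deltaFun_of_not_isIdem hp]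
  let w' : G → WithLp 2 (S.ℰ × ℂ) := fun x => WithLp.toLp 2 (w x, star (deltaFun ℂ x))
  let r' : G → WithLp 2 (S.ℰ × ℂ) := fun x => WithLp.toLp 2 (r x, star (S.transfer E x))
  -- Equivalently `U*w' = r'`: taking adjoints, this combines `h = δ + HA` with `W = Dδ + CHB`.
  -- Since `U` preserves inner products, comparing those of `r'` and `w'` gives the claim.
  have hU : ∀ x, S.U (r' x) = w' x := by
    intro x
    rw [← LinearIsometryEquiv.eq_symm_apply]
    refine ext_inner_right ℂ fun v => ?_
    have e1 : inner ℂ (S.U.symm (w' x)) v = inner ℂ (w' x) (S.U v) := by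
      rw [← S.U.inner_map_map, LinearIsometryEquiv.apply_symm_apply]
    rw [e1]
    obtain ⟨⟨ξ, z⟩⟩ := v
    have e2 : S.U (WithLp.toLp 2 (ξ, z)) = WithLp.toLp 2 (S.A ξ + z • S.B, S.C ξ + S.D * z) := by
      rw [← S.prodU_eq]
      rfl
    rw [e2]
    simp only [w', r', w, r, h, WithLp.prod_inner_apply, ContinuousLinearMap.adjoint_inner_left,
      hc, RCLike.inner_apply, hW]
    by_cases hx : IsIdem x
    · simp [deltaFun_of_isIdem hx]
      ring
    · simp [deltaFun_of_not_isIdem hx]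
  refine ⟨r, fun x y => ?_⟩
  have h1 : inner ℂ (r' x) (r' y) = inner ℂ (w' x) (w' y) := by
    rw [← hU, ← hU, LinearIsometryEquiv.inner_map_map]
  have h2 : inner ℂ (w x) (w y) = ∑ p ∈ factorPairs x, ∑ v ∈ factorPairs y, inner ℂ (r p.1)
      (S.ρ (E p.2 * star (E v.2)) (r v.1)) := by
    rw [hw, hw, sum_inner]
    refine Finset.sum_congr rfl fun p _ => ?_
    rw [inner_sum]
    refine Finset.sum_congr rfl fun v _ => ?_
    rw [ContinuousLinearMap.adjoint_inner_left, map_mul, map_star,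
      ContinuousLinearMap.star_eq_adjoint, mul_apply_eq_comp]
  have h3 : ∑ p ∈ factorPairs x, ∑ v ∈ factorPairs y, inner ℂ (r p.1)
        (S.ρ (oneMat (Y →ᵇ ℂ) p.2 v.2) (r v.1)) = inner ℂ (r x) (r y) := by
    rw [sum_factorPairs_of_right_idem, sum_factorPairs_of_right_idem]
    · simp [oneMat, isIdem_rightUnit]
    · intro v hv
      simp [oneMat, hv]
    · intro p hp
      simp [oneMat, hp]
  simp only [r', w', WithLp.prod_inner_apply, RCLike.inner_apply, h2] at h1
  simp only [Pi.sub_apply, map_sub, _root_.sub_apply, inner_sub_right,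
    Finset.sum_sub_distrib, h3, oneMat_eq_delta, outer]
  simp only [RCLike.star_def, Complex.conj_conj] at h1 ⊢
  linear_combination (-1 : ℂ) * h1

theorem isPosKernel_gram_sum {X J V : Type*} [Fintype J] [NormedAddCommGroup V]
    [InnerProductSpace ℂ V] (A : Finset X) (k : X → X → ℂ) (v : J → X → V)
    (h : ∀ a ∈ A, ∀ b ∈ A, k a b = ∑ j, inner ℂ (v j a) (v j b)) :
    (Matrix.of fun a b : A => k a b).PosSemidef := by
  have : (Matrix.of fun a b : A => k a b) = ∑ j, Matrix.gram ℂ (fun a : A => v j a) := by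
    ext a b
    simp [Matrix.sum_apply, h a a.2 b b.2, Matrix.gram_apply]
  rw [this]
  exact Matrix.posSemidef_sum _ fun j _ => Matrix.posSemidef_gram ℂ _

/-- The matrix `N = ([1] - EE*) ⋆ k` over `C_b(Ψ)` takes at `ψ` the value `([1] - ψψ*) ⋆ k ≥ 0`, so
it factors as `∑ sₗsₗ*`. By associativity the kernel is `∑ ⟨r, ρ(N)r⟩`, a sum over `l` of Gram
matrices of the vectors `∑ ρ(sₗ)*r`. -/
theorem UnitaryColligation.isPosKernel_transfer {Ψ : Set (G → ℂ)} (hΨ : IsTestFamily Ψ)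
    (S : UnitaryColligation (Ψ →ᵇ ℂ)) (k : G → G → ℂ) (hk : k ∈ kernelFamily Ψ) :
    IsPosKernel (kconv (oneMat ℂ - outer (S.transfer (evalMap hΨ))) k) := by
  classical
  intro A
  set E := evalMap hΨ with hEdef
  obtain ⟨r, hr⟩ := S.exists_left_vectors E
    fun e he => (norm_starAlgHom_le S.ρ _).trans_lt (hΨ.norm_evalMap_lt he)
  let N : G → G → (Ψ →ᵇ ℂ) := fun m m' => ∑ u ∈ factorPairs m, ∑ v ∈ factorPairs m',
    k u.2 v.2 • (oneMat (Ψ →ᵇ ℂ) - outer E : G → G → (Ψ →ᵇ ℂ)) u.1 v.1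
  have hN : ∀ m m' (ψ : Ψ), N m m' ψ = kconv (oneMat ℂ - outer (ψ : G → ℂ)) k m m' := by
    intro m m' ψ
    simp only [N, kconv, BoundedContinuousFunction.sum_apply]
    refine Finset.sum_congr rfl fun p _ => Finset.sum_congr rfl fun v _ => ?_
    have : (oneMat (Ψ →ᵇ ℂ) p.1 v.1) ψ = oneMat ℂ p.1 v.1 := by
      simp only [oneMat]
      split_ifs <;> rfl
    simp only [Pi.sub_apply, BoundedContinuousFunction.smul_apply,
      BoundedContinuousFunction.sub_apply, this, smul_eq_mul]
    rw [mul_comm]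
    rfl
  let X : Finset G := A.biUnion fun a => (factorPairs a).image Prod.snd
  have hX : ∀ a ∈ A, ∀ p ∈ factorPairs a, p.2 ∈ X := fun a ha p hp =>
    Finset.mem_biUnion.2 ⟨a, ha, Finset.mem_image_of_mem _ hp⟩
  obtain ⟨s, hs⟩ := exists_matrix_factorization (X := X) (fun i j => N i j) fun ψ => by
    simp only [hN]
    exact hk.2 ψ.1 ψ.2 X
  let s' : X → G → (Ψ →ᵇ ℂ) := fun l m => if hm : m ∈ X then s ⟨m, hm⟩ l else 0
  have hs' : ∀ m ∈ X, ∀ m' ∈ X, N m m' = ∑ l, s' l m * star (s' l m') := by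
    intro m hm m' hm'
    simpa [s', hm, hm'] using hs ⟨m, hm⟩ ⟨m', hm'⟩
  refine isPosKernel_gram_sum A _
    (fun (l : X) (a : G) => ∑ p ∈ factorPairs a, S.ρ (star (s' l p.2)) (r p.1)) ?_
  intro a ha b hb
  have e1 : kconv (oneMat ℂ - outer (S.transfer E)) k a b =
      ∑ p ∈ factorPairs a, ∑ v ∈ factorPairs b, inner ℂ (r p.1) (S.ρ (N p.2 v.2) (r v.1)) := by
    simp only [kconv, hr, Finset.sum_mul]
    rw [sum_kernel_assoc (fun p v x y z z' => inner ℂ (r p) (S.ρ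
      ((oneMat (Ψ →ᵇ ℂ) - outer E : G → G → (Ψ →ᵇ ℂ)) x y) (r v)) * k z z')]
    refine Finset.sum_congr rfl fun p _ => Finset.sum_congr rfl fun v _ => ?_
    simp only [N, map_sum, _root_.sum_apply, inner_sum, map_smul,
      _root_.smul_apply, inner_smul_right]
    exact Finset.sum_congr rfl fun p _ => Finset.sum_congr rfl fun v _ => mul_comm _ _
  rw [e1]
  symm
  simp only [sum_inner]
  rw [Finset.sum_comm]
  refine Finset.sum_congr rfl fun p hp => ?_
  simp only [inner_sum]
  rw [Finset.sum_comm]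
  refine Finset.sum_congr rfl fun v hv => ?_
  symm
  rw [hs' _ (hX a ha p hp) _ (hX b hb v hv)]
  simp only [map_sum, _root_.sum_apply, inner_sum]
  refine Finset.sum_congr rfl fun l _ => ?_
  rw [map_mul, mul_apply_eq_comp, map_star S.ρ (s' l p.2), ContinuousLinearMap.star_eq_adjoint,
    ContinuousLinearMap.adjoint_inner_left]

end TransferPositive

/-! ## Matrices and recursions -/

section MatrixLemmas

open Filter Topology

theorem tendsto_zero_of_contraction_add {c : ℂ} (hc : ‖c‖ < 1) {a b : ℕ → ℂ}
    (hb : Tendsto b atTop (𝓝 0)) (h : ∀ n, a (n + 1) = c * a n + b n) :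
    Tendsto a atTop (𝓝 0) := by
  rw [Metric.tendsto_atTop] at hb ⊢
  simp only [dist_zero_right] at hb ⊢
  intro ε hε
  have hd : 0 < 1 - ‖c‖ := by linarith
  -- With this threshold `ε / 2` is a fixed point of `t ↦ ‖c‖t + (ε / 2)(1 - ‖c‖)`, so it survives
  -- the iteration.
  obtain ⟨N, hN⟩ := hb (ε / 2 * (1 - ‖c‖)) (by positivity)
  have hstep : ∀ m, ‖a (N + m)‖ ≤ ‖c‖ ^ m * ‖a N‖ + ε / 2 := by
    intro m
    induction m with
    | zero => simp; positivity
    | succ m ih =>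
      rw [← add_assoc, h]
      have h1 := hN (N + m) (by omega)
      calc ‖c * a (N + m) + b (N + m)‖ ≤ ‖c‖ * ‖a (N + m)‖ + ‖b (N + m)‖ := by
            rw [← norm_mul]; exact norm_add_le _ _
        _ ≤ ‖c‖ * (‖c‖ ^ m * ‖a N‖ + ε / 2) + ε / 2 * (1 - ‖c‖) := by gcongr
        _ = _ := by ring
  have hp : Tendsto (fun m => ‖c‖ ^ m * ‖a N‖) atTop (𝓝 0) := by
    simpa using (tendsto_pow_atTop_nhds_zero_of_lt_one (norm_nonneg c) hc).mul_const ‖a N‖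
  obtain ⟨K, hK⟩ := (hp.eventually_lt_const (half_pos hε)).exists_forall_of_atTop
  refine ⟨N + K, fun n hn => ?_⟩
  obtain ⟨m, rfl⟩ := Nat.exists_eq_add_of_le (show N ≤ n by omega)
  have := hstep m
  have := hK m (by omega)
  linarith
open scoped Matrix.Norms.L2Operator MatrixOrder

theorem one_sub_conjTranspose_mul_self_posSemidef {X : Type*} [Fintype X] [DecidableEq X]
    (T : Matrix X X ℂ) (h : ‖Matrix.toEuclideanCLM (n := X) (𝕜 := ℂ) T‖ ≤ 1) :
    (1 - T.conjTranspose * T).PosSemidef := by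
  rw [← Matrix.cstar_norm_def] at h
  rw [← Matrix.le_iff, ← Matrix.star_eq_conjTranspose,
    ← CStarAlgebra.norm_le_one_iff_of_nonneg _ (star_mul_self_nonneg T),
    CStarRing.norm_star_mul_self]
  exact mul_le_one₀ h (norm_nonneg _) h

/-- Both matrices are Schur complements of the block matrix with rows `(J⁻¹, T)` and `(T*, J)`. This
translates conditions on a kernel into conditions on its inverse, the weight. -/
theorem posSemidef_inv_sub_iff {X : Type*} [Fintype X] [DecidableEq X] {J : Matrix X X ℂ}
    (hJ : J.PosDef) (T : Matrix X X ℂ) :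
    (J⁻¹ - T * J⁻¹ * T.conjTranspose).PosSemidef ↔ (J - T.conjTranspose * J * T).PosSemidef := by
  have hu := hJ.isUnit
  have : Invertible J := hu.invertible
  have : Invertible J⁻¹ := hJ.inv.isUnit.invertible
  rw [← Matrix.PosDef.fromBlocks₂₂ _ _ hJ, Matrix.PosDef.fromBlocks₁₁ _ _ hJ.inv,
    Matrix.inv_inv_of_invertible]

theorem posSemidef_of_forall_add_smul {X : Type*} [Finite X]
    (A B : Matrix X X ℂ) (h : ∀ ε : ℝ, 0 < ε → (A + (ε : ℂ) • B).PosSemidef) : A.PosSemidef := by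
  classical
  have := Fintype.ofFinite X
  have h0 : Tendsto (fun ε : ℝ => A + (ε : ℂ) • B) (𝓝[>] 0) (𝓝 (A + ((0 : ℝ) : ℂ) • B)) := by
    refine Tendsto.mono_left ?_ nhdsWithin_le_nhds
    have : Continuous fun ε : ℝ => A + (ε : ℂ) • B := by fun_prop
    exact this.tendsto 0
  rw [Complex.ofReal_zero, zero_smul, add_zero] at h0
  rw [← Matrix.nonneg_iff_posSemidef]
  refine ge_of_tendsto h0 ?_
  filter_upwards [self_mem_nhdsWithin] with ε hε
  exact Matrix.nonneg_iff_posSemidef.2 (h ε hε)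

end MatrixLemmas

/-! ## Toeplitz matrices on finite lower sets -/

section Toeplitz

open PartialMul Matrix

variable {G : Type u} [Semigroupoid G]

theorem mem_of_mem_factorPairs {F : Set G} (hF : IsLower F) {a : G} (ha : a ∈ F) {p : G × G}
    (hp : p ∈ factorPairs a) : p.2 ∈ F :=
  hF a ha _ ⟨p.1, rightUnit a, by simp [pmul₃, mem_factorPairs.1 hp, pmul_rightUnit]⟩

/-- The Toeplitz matrix represents left convolution; lowerness keeps all right factors inside `F`.
-/
theorem toeplitz_mulVec {F : Finset G} (hF : IsLower (F : Set G)) (ψ f : G → ℂ) (a : F) :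
    (toeplitz F ψ *ᵥ fun b : F => f b) a = conv ψ f a := by
  classical
  simp only [mulVec, dotProduct, toeplitz, of_apply, Finset.sum_mul]
  rw [Finset.sum_coe_sort F (fun b => ∑ p ∈ factorPairs (a : G) with p.2 = b, ψ p.1 * f b), conv,
    ← Finset.sum_fiberwise_of_maps_to (t := F) (g := fun p : G × G => p.2)
      fun p hp => mem_of_mem_factorPairs hF a.2 hp]
  refine Finset.sum_congr rfl fun b _ => Finset.sum_congr rfl fun p hp => ?_
  rw [(Finset.mem_filter.1 hp).2, smul_eq_mul]

theorem toeplitz_mul_mul_conjTranspose {F : Finset G} (hF : IsLower (F : Set G)) (ψ : G → ℂ)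
    (k : G → G → ℂ) (a b : F) :
    (toeplitz F ψ * (Matrix.of fun x y : F => k x y) * (toeplitz F ψ)ᴴ) a b =
      ∑ p ∈ factorPairs (a : G), ∑ r ∈ factorPairs (b : G), ψ p.1 * star (ψ r.1) * k p.2 r.2 := by
  have h1 : ∀ (c : F), (toeplitz F ψ * (Matrix.of fun x y : F => k x y)) a c =
      conv ψ (fun x => k x c) a := by
    intro c
    rw [← toeplitz_mulVec hF]
    rfl
  have h2 : (toeplitz F ψ * (Matrix.of fun x y : F => k x y) * (toeplitz F ψ)ᴴ) a b =
      star ((toeplitz F ψ *ᵥ fun c : F => star (conv ψ (fun x => k x c) a)) b) := by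
    rw [Matrix.mul_apply, mulVec, dotProduct, star_sum]
    refine Finset.sum_congr rfl fun c _ => ?_
    rw [h1, conjTranspose_apply, star_mul, star_star, mul_comm, mul_comm]
  rw [h2, toeplitz_mulVec hF ψ (fun c => star (conv ψ (fun x => k x c) a))]
  simp only [conv, star_sum, smul_eq_mul, star_mul, star_star, Finset.sum_mul]
  rw [Finset.sum_comm]
  refine Finset.sum_congr rfl fun p _ => Finset.sum_congr rfl fun r _ => by ring

theorem kconv_eq_toeplitz {F : Finset G} (hF : IsLower (F : Set G)) (ψ : G → ℂ) (k : G → G → ℂ) :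
    (Matrix.of fun x y : F => kconv (oneMat ℂ - outer ψ) k x y) =
      (Matrix.of fun x y : F => k x y) -
        toeplitz F ψ * (Matrix.of fun x y : F => k x y) * (toeplitz F ψ)ᴴ := by
  ext a b
  rw [Matrix.sub_apply, toeplitz_mul_mul_conjTranspose hF]
  have := kconv_one_smul_sub 1 ψ k (a : G) b
  rw [one_smul, one_mul] at this
  exact this

/-- Convolution by `ψ` is triangular with diagonal entries of modulus below `1`. By induction along
`LeftLt`, the off-diagonal part of the recursion at `x` is a null sequence. -/
theorem tendsto_conv_iterate {ψ : G → ℂ} (hψ : ∀ e, IsIdem e → ‖ψ e‖ < 1) (f : G → ℂ) (x : G) :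
    Filter.Tendsto (fun n => (conv ψ)^[n] f x) Filter.atTop (nhds 0) := by
  refine wellFounded_leftLt.induction (C := fun x =>
    Filter.Tendsto (fun n => (conv ψ)^[n] f x) Filter.atTop (nhds 0)) x ?_
  intro x ih
  have hb : Filter.Tendsto (fun n => ∑ p ∈ properPairs x, ψ p.1 * (conv ψ)^[n] f p.2)
      Filter.atTop (nhds 0) := by
    have := tendsto_finsetSum (properPairs x) fun p hp =>
      (ih p.2 (leftLt_of_mem_properPairs hp)).const_mul (ψ p.1)
    simpa using this
  have hrec : ∀ n, (conv ψ)^[n + 1] f x = ψ (leftUnit x) * (conv ψ)^[n] f x +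
      ∑ p ∈ properPairs x, ψ p.1 * (conv ψ)^[n] f p.2 := by
    intro n
    rw [Function.iterate_succ_apply', conv_split]
    rfl
  have hc := hψ _ (isIdem_leftUnit x)
  exact tendsto_zero_of_contraction_add hc hb hrec

/-- The coordinate restriction from functions on `F'` to functions on `F`. -/
noncomputable def restrictMat {G : Type u} (F F' : Finset G) : Matrix F F' ℂ := by
  classical exact Matrix.of fun f x => if (f : G) = x then 1 else 0

open Classical in
theorem restrictMat_conj_apply {G : Type u} {F F' : Finset G} (K : Matrix F F ℂ) (x y : F') :
    ((restrictMat F F')ᴴ * K * restrictMat F F') x y =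
      if h : (x : G) ∈ F ∧ (y : G) ∈ F then K ⟨x, h.1⟩ ⟨y, h.2⟩ else 0 := by
  have h1 : ∀ (z : F') (hz : (z : G) ∈ F) (f : F),
      restrictMat F F' f z = if f = ⟨z, hz⟩ then 1 else 0 := by
    intro z hz f
    simp only [restrictMat, Matrix.of_apply, Subtype.ext_iff]
  have h0 : ∀ (z : F') (hz : (z : G) ∉ F) (f : F), restrictMat F F' f z = 0 := by
    intro z hz f
    have : (f : G) ≠ z := fun h => hz (h ▸ f.2)
    simp [restrictMat, this]
  simp only [Matrix.mul_apply, conjTranspose_apply]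
  by_cases hx : (x : G) ∈ F
  · by_cases hy : (y : G) ∈ F
    · simp [h1 x hx, h1 y hy, hx, hy, apply_ite star]
    · simp [h0 y hy, hy]
  · simp [h0 x hx, hx]

open Classical in
theorem restrictMat_mul_conjTranspose {G : Type u} {F F' : Finset G} (hFF : F ⊆ F') :
    restrictMat F F' * (restrictMat F F')ᴴ = 1 := by
  ext f g
  simp only [Matrix.mul_apply, conjTranspose_apply, restrictMat, Matrix.of_apply]
  rw [Finset.sum_eq_single ⟨f, hFF f.2⟩]
  · by_cases hfg : f = g
    · subst hfg
      simp
    · have : (g : G) ≠ f := fun h => hfg (Subtype.ext h.symm)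
      simp [hfg, this]
  · intro b _ hb
    have : (f : G) ≠ b := fun h => hb (Subtype.ext h.symm)
    simp [this]
  · simp

/-- As `F` is lower, the rows of the larger Toeplitz matrix indexed by `F` vanish in columns off
`F`. -/
theorem restrictMat_mul_toeplitz {F F' : Finset G} (hF : IsLower (F : Set G)) (hFF : F ⊆ F')
    (ψ : G → ℂ) : restrictMat F F' * toeplitz F' ψ = toeplitz F ψ * restrictMat F F' := by
  classical
  ext f x
  simp only [Matrix.mul_apply, restrictMat, Matrix.of_apply]
  rw [Finset.sum_eq_single ⟨f, hFF f.2⟩]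
  · simp only [if_true, one_mul, toeplitz, Matrix.of_apply]
    by_cases hx : (x : G) ∈ F
    · rw [Finset.sum_eq_single (⟨x, hx⟩ : F)]
      · simp
      · intro b _ hb
        have : (b : G) ≠ x := fun h => hb (Subtype.ext h)
        simp [this]
      · simp
    · trans (0 : ℂ)
      swap
      · symm
        refine Finset.sum_eq_zero fun b _ => ?_
        have : (b : G) ≠ x := fun h => hx (h ▸ b.2)
        simp [this]
      · refine Finset.sum_eq_zero fun p hp => ?_
        exfalso
        rw [Finset.mem_filter] at hp
        exact hx (hp.2 ▸ mem_of_mem_factorPairs hF f.2 hp.1)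
  · intro b _ hb
    have : (f : G) ≠ b := fun h => hb (Subtype.ext h.symm)
    simp [this]
  · simp

open Classical in
/-- The kernel `K` on `F`, extended by a multiple of the identity off `F`. -/
noncomputable def diagExtend {G : Type u} {F : Finset G} (K : Matrix F F ℂ) (c : ℂ) (x y : G) : ℂ :=
  if h : x ∈ F ∧ y ∈ F then K ⟨x, h.1⟩ ⟨y, h.2⟩ else if x = y then c else 0

open Classical in
theorem diagExtend_eq {G : Type u} {F F' : Finset G} (K : Matrix F F ℂ) (c : ℂ) :
    (Matrix.of fun x y : F' => diagExtend K c x y) =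
      (restrictMat F F')ᴴ * K * restrictMat F F' +
        c • (1 - (restrictMat F F')ᴴ * restrictMat F F') := by
  have h1 : (restrictMat F F')ᴴ * restrictMat F F' =
      (restrictMat F F')ᴴ * (1 : Matrix F F ℂ) * restrictMat F F' := by rw [Matrix.mul_one]
  rw [h1]
  ext x y
  simp only [Matrix.add_apply, Matrix.smul_apply, Matrix.sub_apply, restrictMat_conj_apply,
    Matrix.of_apply, diagExtend, Matrix.one_apply, Subtype.ext_iff, smul_eq_mul]
  by_cases h : (x : G) ∈ F ∧ (y : G) ∈ F
  · by_cases hxy : (x : G) = y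
    · simp [h, hxy]
    · simp [h, hxy]
  · by_cases hxy : (x : G) = y
    · have hy : (y : G) ∉ F := fun hy => h ⟨hxy ▸ hy, hy⟩
      simp [hxy, hy]
    · simp [h, hxy]

open Classical in
/-- A weight on a finite lower set for which all Toeplitz matrices are contractive gives a member
of `kernelFamily Ψ`. -/
theorem diagExtend_mem_kernelFamily {Ψ : Set (G → ℂ)} (hΨ : IsTestFamily Ψ) {F : Finset G}
    (hF : IsLower (F : Set G)) {Λ : Matrix F F ℂ} (hΛ : Λ.PosSemidef)
    (hT : ∀ ψ ∈ Ψ, (Λ - (toeplitz F ψ)ᴴ * Λ * toeplitz F ψ).PosSemidef) {ε : ℝ} (hε : 0 < ε) :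
    diagExtend (Λ + (ε : ℂ) • (1 : Matrix F F ℂ))⁻¹ (ε : ℂ)⁻¹ ∈ kernelFamily Ψ := by
  have hε' : (0 : ℂ) < ε := by exact_mod_cast hε
  have hΛε : (Λ + (ε : ℂ) • (1 : Matrix F F ℂ)).PosDef :=
    Matrix.PosDef.posSemidef_add hΛ (Matrix.PosDef.one.smul hε')
  set k : G → G → ℂ := diagExtend (Λ + (ε : ℂ) • (1 : Matrix F F ℂ))⁻¹ (ε : ℂ)⁻¹ with hk
  have main : ∀ A : Finset G, ∃ F' : Finset G, IsLower (F' : Set G) ∧ A ⊆ F' ∧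
      (Matrix.of fun x y : F' => k x y).PosSemidef ∧
      ∀ ψ ∈ Ψ, (Matrix.of fun x y : F' => kconv (oneMat ℂ - outer ψ) k x y).PosSemidef := by
    intro A
    obtain ⟨F', hF', hAF⟩ := exists_finite_lower (A ∪ F)
    have hFF : F ⊆ F' := Finset.subset_union_right.trans hAF
    refine ⟨F', hF', Finset.subset_union_left.trans hAF, ?_⟩
    set P := restrictMat F F' with hP
    have hPP : P * Pᴴ = 1 := restrictMat_mul_conjTranspose hFF
    -- The inverse of `k` on `F'`: the weight `Λ` is extended by zero before `ε` is added.
    let J : Matrix F' F' ℂ := Pᴴ * Λ * P + (ε : ℂ) • 1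
    have hJ : J.PosDef :=
      Matrix.PosDef.posSemidef_add (hΛ.conjTranspose_mul_mul_same P) (Matrix.PosDef.one.smul hε')
    have hJi : J⁻¹ = Matrix.of fun x y : F' => k x y := by
      rw [hk, diagExtend_eq]
      apply Matrix.inv_eq_right_inv
      have hJ' : J = Pᴴ * (Λ + (ε : ℂ) • (1 : Matrix F F ℂ)) * P + (ε : ℂ) • (1 - Pᴴ * P) := by
        simp only [J, Matrix.mul_add, Matrix.add_mul, Matrix.mul_smul, Matrix.smul_mul,
          Matrix.mul_one, smul_sub]
        abel
      have hu := hΛε.isUnit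
      rw [Matrix.isUnit_iff_isUnit_det] at hu
      have e1 : P * (1 - Pᴴ * P) = 0 := by
        rw [Matrix.mul_sub, ← Matrix.mul_assoc, hPP, Matrix.mul_one, Matrix.one_mul, sub_self]
      have e2 : (1 - Pᴴ * P) * Pᴴ = 0 := by
        rw [Matrix.sub_mul, Matrix.mul_assoc, hPP, Matrix.mul_one, Matrix.one_mul, sub_self]
      have e3 : Pᴴ * (Λ + (ε : ℂ) • (1 : Matrix F F ℂ)) * P * (Pᴴ * (Λ + (ε : ℂ) • (1 : Matrix F F ℂ))⁻¹ * P) = Pᴴ * P := by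
        calc _ = Pᴴ * (Λ + (ε : ℂ) • (1 : Matrix F F ℂ)) * (P * Pᴴ) * (Λ + (ε : ℂ) • (1 : Matrix F F ℂ))⁻¹ * P := by
              simp only [Matrix.mul_assoc]
          _ = Pᴴ * ((Λ + (ε : ℂ) • (1 : Matrix F F ℂ)) * (Λ + (ε : ℂ) • (1 : Matrix F F ℂ))⁻¹) * P := by
              rw [hPP, Matrix.mul_one]; simp only [Matrix.mul_assoc]
          _ = _ := by rw [Matrix.mul_nonsing_inv _ hu, Matrix.mul_one]
      have e4 : (1 - Pᴴ * P) * (1 - Pᴴ * P) = 1 - Pᴴ * P := by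
        rw [Matrix.mul_sub, ← Matrix.mul_assoc, e2, Matrix.zero_mul, Matrix.mul_one, sub_zero]
      rw [hJ', ← hP, Matrix.add_mul (Pᴴ * (Λ + (ε : ℂ) • (1 : Matrix F F ℂ)) * P),
        Matrix.mul_add (Pᴴ * (Λ + (ε : ℂ) • (1 : Matrix F F ℂ)) * P),
        Matrix.mul_add ((ε : ℂ) • (1 - Pᴴ * P)), e3]
      have e5 : Pᴴ * (Λ + (ε : ℂ) • (1 : Matrix F F ℂ)) * P * ((ε : ℂ)⁻¹ • (1 - Pᴴ * P)) = 0 := by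
        rw [Matrix.mul_smul, Matrix.mul_assoc, e1, Matrix.mul_zero, smul_zero]
      have e6 : (ε : ℂ) • (1 - Pᴴ * P) * (Pᴴ * (Λ + (ε : ℂ) • (1 : Matrix F F ℂ))⁻¹ * P) = 0 := by
        rw [Matrix.smul_mul, Matrix.mul_assoc Pᴴ, ← Matrix.mul_assoc, e2, Matrix.zero_mul,
          smul_zero]
      have e7 : (ε : ℂ) • (1 - Pᴴ * P) * ((ε : ℂ)⁻¹ • (1 - Pᴴ * P)) = 1 - Pᴴ * P := by
        rw [Matrix.smul_mul, Matrix.mul_smul, e4, smul_smul, mul_inv_cancel₀ hε'.ne', one_smul]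
      rw [e5, e6, e7]
      abel
    refine ⟨hJi ▸ hJ.inv.posSemidef, fun ψ hψ => ?_⟩
    rw [kconv_eq_toeplitz hF', ← hJi, posSemidef_inv_sub_iff hJ]
    have hPT : P * toeplitz F' ψ = toeplitz F ψ * P := restrictMat_mul_toeplitz hF hFF ψ
    have hTP : (toeplitz F' ψ)ᴴ * Pᴴ = Pᴴ * (toeplitz F ψ)ᴴ := by
      rw [← conjTranspose_mul, hPT, conjTranspose_mul]
    -- Both summands are positive: the first by the hypothesis on `Λ`, the second by contractivity
    -- of Toeplitz matrices on `F'`.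
    have e : J - (toeplitz F' ψ)ᴴ * J * toeplitz F' ψ =
        Pᴴ * (Λ - (toeplitz F ψ)ᴴ * Λ * toeplitz F ψ) * P +
          (ε : ℂ) • (1 - (toeplitz F' ψ)ᴴ * toeplitz F' ψ) := by
      have e1 : (toeplitz F' ψ)ᴴ * (Pᴴ * Λ * P) * toeplitz F' ψ =
          Pᴴ * ((toeplitz F ψ)ᴴ * Λ * toeplitz F ψ) * P := by
        calc _ = ((toeplitz F' ψ)ᴴ * Pᴴ) * Λ * (P * toeplitz F' ψ) := by
              simp only [Matrix.mul_assoc]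
          _ = _ := by rw [hTP, hPT]; simp only [Matrix.mul_assoc]
      simp only [J, Matrix.mul_add, Matrix.add_mul, e1, Matrix.mul_sub, Matrix.sub_mul,
        Matrix.mul_smul, Matrix.smul_mul, Matrix.mul_one, smul_sub]
      abel
    rw [e]
    exact ((hT ψ hψ).conjTranspose_mul_mul_same P).add
      ((one_sub_conjTranspose_mul_self_posSemidef _ (hΨ.toeplitz_le F' hF' ψ hψ)).smul hε'.le)
  constructor
  · intro A
    obtain ⟨F', -, hA, h, -⟩ := main A
    exact h.submatrix fun a : A => (⟨a, hA a.2⟩ : F')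
  · intro ψ hψ A
    obtain ⟨F', -, hA, -, h⟩ := main A
    exact (h ψ hψ).submatrix fun a : A => (⟨a, hA a.2⟩ : F')

end Toeplitz

/-! ## From the norm bound to kernels on finite lower sets -/

section Separation

open PartialMul Matrix Filter Topology

variable {G : Type u} [Semigroupoid G]

/-- The constant `1` need not be known to be admissible, so some admissible `C` with `C² ≤ 1 + ε` is
used. Adding `(1 + ε - C²)k` gives positivity up to `εk`, and `ε → 0`. -/
theorem isPosKernel_of_hInftyNorm_le_one {Ψ : Set (G → ℂ)} {φ : G → ℂ} (h : MemHInfty Ψ φ)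
    (h1 : hInftyNorm Ψ φ ≤ 1) {k : G → G → ℂ} (hk : k ∈ kernelFamily Ψ) :
    IsPosKernel (kconv (oneMat ℂ - outer φ) k) := by
  intro A
  refine posSemidef_of_forall_add_smul _ (Matrix.of fun a b : A => k a b) fun ε hε => ?_
  have hlt : hInftyNorm Ψ φ < √(1 + ε) := h1.trans_lt (by
    rw [Real.lt_sqrt zero_le_one]; linarith)
  obtain ⟨C, ⟨hC0, hC⟩, hCε⟩ := exists_lt_of_csInf_lt h hlt
  have hC2 : C ^ 2 ≤ 1 + ε := ((Real.lt_sqrt hC0.le).1 hCε).le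
  have h2 : (0 : ℂ) ≤ ((1 + ε - C ^ 2 : ℝ) : ℂ) := by
    rw [Complex.zero_le_real]
    linarith
  convert (hC k hk A).add ((hk.1 A).smul h2) using 1
  ext a b
  have e1 := kconv_one_smul_sub 1 φ k (a : G) b
  rw [one_smul] at e1
  simp only [Matrix.add_apply, Matrix.smul_apply, Matrix.of_apply, e1, kconv_one_smul_sub,
    smul_eq_mul]
  push_cast
  ring

/-- `Λ` is minus the Hermitian part of the matrix representing `f`; the sign turns a functional that
is nonpositive on the cone into a weight with `T*ΛT ≤ Λ`. -/
theorem exists_hermitian_of_functional {F : Type*} [Fintype F] (f : (F → F → ℂ) →L[ℂ] ℂ) :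
    ∃ Λ : Matrix F F ℂ, Λ.IsHermitian ∧ ∀ x : F → ℂ,
      star x ⬝ᵥ (Λ *ᵥ x) = -(((f fun a b => x a * star (x b)).re : ℝ) : ℂ) := by
  classical
  let n : F → F → ℂ := fun a b => f (Pi.single a (Pi.single b 1))
  have hf : ∀ Q : F → F → ℂ, f Q = ∑ a, ∑ b, Q a b * n a b := by
    intro Q
    have hQ : Q = ∑ a, ∑ b, Q a b • (Pi.single a (Pi.single b 1) : F → F → ℂ) := by
      ext i j
      simp only [Finset.sum_apply, Pi.smul_apply, smul_eq_mul]
      rw [Finset.sum_eq_single i, Finset.sum_eq_single j]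
      · simp
      · intro b _ hb
        simp [hb.symm]
      · simp
      · intro a _ ha
        simp [ha.symm]
      · simp
    conv_lhs => rw [hQ]
    simp only [map_sum, map_smul, smul_eq_mul, n]
  refine ⟨Matrix.of fun b a => -(n a b + star (n b a)) / 2, ?_, ?_⟩
  · ext a b
    simp [Matrix.conjTranspose_apply]
    ring
  · intro x
    have h1 : star x ⬝ᵥ ((Matrix.of fun b a => -(n a b + star (n b a)) / 2) *ᵥ x) =
        -((f fun a b => x a * star (x b)) + star (f fun a b => x a * star (x b))) / 2 := by
      rw [hf]
      have h2 : star (∑ a, ∑ b, x a * star (x b) * n a b) =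
          ∑ a, ∑ b, x a * star (x b) * star (n b a) := by
        rw [Finset.sum_comm]
        simp only [star_sum, star_mul, star_star]
        refine Finset.sum_congr rfl fun a _ => Finset.sum_congr rfl fun b _ => by ring
      rw [h2, ← Finset.sum_add_distrib]
      simp only [← Finset.sum_add_distrib, dotProduct, mulVec, Matrix.of_apply, Finset.mul_sum,
        Pi.star_apply]
      rw [Finset.sum_comm, neg_div, Finset.sum_div, ← Finset.sum_neg_distrib]
      refine Finset.sum_congr rfl fun a _ => ?_
      rw [Finset.sum_div, ← Finset.sum_neg_distrib]
      refine Finset.sum_congr rfl fun b _ => ?_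
      ring
    rw [h1, RCLike.star_def, Complex.add_conj]
    push_cast
    ring

theorem star_dotProduct_conj_mulVec {F : Type*} [Fintype F] (Λ T : Matrix F F ℂ) (x : F → ℂ) :
    star x ⬝ᵥ ((Tᴴ * Λ * T) *ᵥ x) = star (T *ᵥ x) ⬝ᵥ (Λ *ᵥ (T *ᵥ x)) := by
  rw [star_mulVec, ← dotProduct_mulVec, mulVec_mulVec, mulVec_mulVec, Matrix.mul_assoc]

/-- The rank one kernel supported at a point `y`. -/
theorem exists_point_kernel {Y : Type u} [TopologicalSpace Y] (E : G → (Y →ᵇ ℂ)) (y : Y)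
    (f : G → ℂ) : ∃ Γ : G → G → StrongDual ℂ (Y →ᵇ ℂ), IsPosDualKernel Γ ∧
      ∀ a b, khat Γ (oneMat (Y →ᵇ ℂ) - outer E) a b =
        f a * star (f b) - conv (fun x => E x y) f a * star (conv (fun x => E x y) f b) := by
  refine ⟨fun a b => (f a * star (f b)) • BoundedContinuousFunction.evalCLM ℂ y, ?_, ?_⟩
  · intro A g
    have : ∑ a ∈ A, ∑ b ∈ A, ((f a * star (f b)) • BoundedContinuousFunction.evalCLM ℂ y)
        (g a * star (g b)) = star (∑ a ∈ A, f a * g a y) * ∑ a ∈ A, f a * g a y := by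
      rw [mul_comm, star_sum, Finset.sum_mul_sum]
      refine Finset.sum_congr rfl fun a _ => Finset.sum_congr rfl fun b _ => ?_
      simp
      ring
    rw [this]
    exact star_mul_self_nonneg _
  · intro a b
    rw [khat_one_sub]
    congr 1
    · simp
    · simp only [conv, star_sum, Finset.sum_mul_sum]
      refine Finset.sum_congr rfl fun p _ => Finset.sum_congr rfl fun r _ => ?_
      simp
      ring

theorem exists_separating_weight {Y : Type u} [TopologicalSpace Y] (E : G → (Y →ᵇ ℂ))
    (hE1 : ∀ x, ‖E x‖ ≤ 1) (hE : ∀ e, IsIdem e → ‖E e‖ < 1) (y₀ : Y) {F : Finset G}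
    (hF : IsLower (F : Set G)) (φ : G → ℂ)
    (h : ¬ ∃ Γ : G → G → StrongDual ℂ (Y →ᵇ ℂ), IsPosDualKernel Γ ∧ ∀ x y : F,
      (oneMat ℂ - outer φ : G → G → ℂ) x y = khat Γ (oneMat (Y →ᵇ ℂ) - outer E) x y) :
    ∃ Λ : Matrix F F ℂ, Λ.PosSemidef ∧
      (∀ y, (Λ - (toeplitz F fun x => E x y)ᴴ * Λ * toeplitz F fun x => E x y).PosSemidef) ∧
      ¬ (Λ - (toeplitz F φ)ᴴ * Λ * toeplitz F φ).PosSemidef := by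
  let 𝒞 : Set (F → F → ℂ) := {P | ∃ Γ : G → G → StrongDual ℂ (Y →ᵇ ℂ), IsPosDualKernel Γ ∧
    ∀ x y : F, P x y = khat Γ (oneMat (Y →ᵇ ℂ) - outer E) x y}
  have hsmul : ∀ (c : ℝ), 0 ≤ c → ∀ P ∈ 𝒞, c • P ∈ 𝒞 := by
    rintro c hc P ⟨Γ, hΓ, hP⟩
    refine ⟨fun x y => (c : ℂ) • Γ x y, ?_, ?_⟩
    · intro A f
      have := hΓ A f
      simp only [_root_.smul_apply, ← Finset.smul_sum]
      exact smul_nonneg (by exact_mod_cast hc) this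
    · intro x y
      simp only [Pi.smul_apply, hP, khat, _root_.smul_apply, Complex.real_smul, smul_eq_mul,
        Finset.mul_sum]
  have hadd : ∀ P ∈ 𝒞, ∀ Q ∈ 𝒞, P + Q ∈ 𝒞 := by
    rintro P ⟨Γ, hΓ, hP⟩ Q ⟨Δ, hΔ, hQ⟩
    refine ⟨fun x y => Γ x y + Δ x y, ?_, ?_⟩
    · intro A f
      simp only [_root_.add_apply, Finset.sum_add_distrib]
      exact add_nonneg (hΓ A f) (hΔ A f)
    · intro x y
      simp only [Pi.add_apply, hP, hQ, khat, _root_.add_apply, Finset.sum_add_distrib]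
  have hconv : Convex ℝ 𝒞 := fun P hP Q hQ a b ha hb _ =>
    hadd _ (hsmul a ha P hP) _ (hsmul b hb Q hQ)
  have hclosed : IsClosed 𝒞 := by
    refine IsSeqClosed.isClosed ?_
    intro P P₀ hP hlim
    choose Γ hΓ hPΓ using hP
    obtain ⟨Γ₀, h0, h1⟩ := exists_posDualKernel_of_tendsto E hE1 hE (F : Set G) hF atTop Γ hΓ
      (extendKernel P₀) (by
        intro x hx y hy
        have h2 := ((hlim.apply_nhds (⟨x, hx⟩ : F)).apply_nhds (⟨y, hy⟩ : F))
        have e := extendKernel_apply P₀ ⟨x, hx⟩ ⟨y, hy⟩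
        simp only at e
        rw [e]
        refine h2.congr fun n => ?_
        exact hPΓ n ⟨x, hx⟩ ⟨y, hy⟩)
    exact ⟨Γ₀, h0, fun x y => by rw [← h1 x x.2 y y.2, extendKernel_apply]⟩
  let P₀ : F → F → ℂ := fun x y => (oneMat ℂ - outer φ : G → G → ℂ) x y
  obtain ⟨f, u, hf, hu⟩ := RCLike.geometric_hahn_banach_closed_point (𝕜 := ℂ) hconv hclosed
    (x := P₀) h
  have hzero : (0 : F → F → ℂ) ∈ 𝒞 := by
    refine ⟨fun _ _ => 0, fun A f => by simp, fun x y => by simp [khat]⟩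
  have hu0 : 0 < u := by simpa using hf 0 hzero
  -- A functional bounded above on a cone is nonpositive there: the multiple of `P` by `u / (f
  -- P).re` would attain the excluded value `u`.
  have hneg : ∀ P ∈ 𝒞, (f P).re ≤ 0 := by
    intro P hP
    by_contra! hpos
    have h1 := hf _ (hsmul (u / (f P).re) (by positivity) P hP)
    rw [f.map_smul_of_tower] at h1
    simp only [RCLike.re_to_complex, Complex.smul_re, smul_eq_mul] at h1
    rw [div_mul_cancel₀ _ hpos.ne'] at h1
    exact lt_irrefl _ h1
  obtain ⟨Λ, hΛ, hΛf⟩ := exists_hermitian_of_functional f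
  have hcontr : ∀ y (x : G → ℂ), star (fun a : F => conv (fun x => E x y) x a) ⬝ᵥ
      (Λ *ᵥ fun a : F => conv (fun x => E x y) x a) ≤
      star (fun a : F => x a) ⬝ᵥ (Λ *ᵥ fun a : F => x a) := by
    intro y x
    rw [hΛf, hΛf, neg_le_neg_iff, Complex.real_le_real]
    obtain ⟨Γ, hΓ, hΓk⟩ := exists_point_kernel E y x
    have h1 := hneg (fun a b : F => khat Γ (oneMat (Y →ᵇ ℂ) - outer E) a b) ⟨Γ, hΓ, fun _ _ => rfl⟩
    have h2 : (fun a b : F => khat Γ (oneMat (Y →ᵇ ℂ) - outer E) a b) =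
        (fun a b : F => x a * star (x b)) - fun a b : F =>
          conv (fun x => E x y) x a * star (conv (fun x => E x y) x b) := by
      funext a b
      exact hΓk a b
    rw [h2, map_sub, Complex.sub_re] at h1
    linarith
  have hext : ∀ x : F → ℂ, ∃ x' : G → ℂ, x = fun a : F => x' a := fun x =>
    ⟨extendZero x, by funext a; simp [extendZero]⟩
  -- The form decreases along iterated convolution with `E(·)(y₀)`, and the iterates tend to `0`, so
  -- its initial value is at least `0`.
  have hΛ0 : Λ.PosSemidef := by
    refine .of_dotProduct_mulVec_nonneg hΛ fun x => ?_
    obtain ⟨x, rfl⟩ := hext x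
    have hn : ∀ n : ℕ, star (fun a : F => (conv fun x => E x y₀)^[n] x a) ⬝ᵥ
        (Λ *ᵥ fun a : F => (conv fun x => E x y₀)^[n] x a) ≤
        star (fun a : F => x a) ⬝ᵥ (Λ *ᵥ fun a : F => x a) := by
      intro n
      induction n with
      | zero => exact le_rfl
      | succ n ih =>
        rw [Function.iterate_succ']
        exact (hcontr y₀ _).trans ih
    have hlim : Tendsto (fun n => fun a : F => (conv fun x => E x y₀)^[n] x a) atTop (𝓝 0) := by
      rw [tendsto_pi_nhds]
      intro a
      exact tendsto_conv_iterate
        (fun e he => ((E e).norm_coe_le_norm y₀).trans_lt (hE e he)) x a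
    have hcont : Continuous fun v : F → ℂ => star v ⬝ᵥ (Λ *ᵥ v) := by
      simp only [dotProduct, mulVec]
      fun_prop
    have h1 := (hcont.tendsto 0).comp hlim
    simp only [star_zero, zero_dotProduct] at h1
    exact le_of_tendsto' h1 hn
  have hherm : ∀ T : Matrix F F ℂ, (Λ - Tᴴ * Λ * T).IsHermitian := fun T =>
    hΛ.sub (Matrix.isHermitian_conjTranspose_mul_mul T hΛ)
  refine ⟨Λ, hΛ0, fun y => ?_, fun hφ => ?_⟩
  · refine .of_dotProduct_mulVec_nonneg (hherm _) fun x => ?_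
    obtain ⟨x, rfl⟩ := hext x
    rw [Matrix.sub_mulVec, dotProduct_sub, star_dotProduct_conj_mulVec, sub_nonneg]
    have h1 : (toeplitz F fun x => E x y) *ᵥ (fun a : F => x a) =
        fun a : F => conv (fun x => E x y) x a := funext fun a => toeplitz_mulVec hF _ x a
    rw [h1]
    exact hcontr y x
  -- Tested at `δ`, where `T(φ)δ = φ`, positivity would give `Re f([1] - φφ*) ≤ 0`, against the
  -- separation `u < Re f([1] - φφ*)` with `u > 0`.
  · have h1 := hφ.dotProduct_mulVec_nonneg (fun a : F => deltaFun ℂ (a : G))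
    have h2 : toeplitz F φ *ᵥ (fun a : F => deltaFun ℂ (a : G)) = fun a : F => φ a := by
      funext a
      rw [toeplitz_mulVec hF φ (deltaFun ℂ), conv_delta]
    rw [Matrix.sub_mulVec, dotProduct_sub, star_dotProduct_conj_mulVec, sub_nonneg, h2, hΛf, hΛf,
      neg_le_neg_iff, Complex.real_le_real] at h1
    have h3 : P₀ = (fun a b : F => deltaFun ℂ (a : G) * star (deltaFun ℂ (b : G))) -
        fun a b : F => φ a * star (φ b) := by
      funext a b
      simp only [P₀, Pi.sub_apply, oneMat_eq_delta, outer]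
    rw [h3, map_sub] at hu
    simp only [RCLike.re_to_complex, Complex.sub_re] at hu
    linarith

theorem diagExtend_self {G : Type u} {F : Finset G} (K : Matrix F F ℂ) (c : ℂ) :
    (Matrix.of fun x y : F => diagExtend K c x y) = K := by
  ext x y
  simp [diagExtend]

theorem exists_kernel_on_finite_lower {Ψ : Set (G → ℂ)} (hΨ : IsTestFamily Ψ) (hne : Ψ.Nonempty)
    {φ : G → ℂ} (h : ∀ k ∈ kernelFamily Ψ, IsPosKernel (kconv (oneMat ℂ - outer φ) k))
    {F : Finset G} (hF : IsLower (F : Set G)) :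
    ∃ Γ : G → G → StrongDual ℂ (Ψ →ᵇ ℂ), IsPosDualKernel Γ ∧ ∀ x y : F,
      (oneMat ℂ - outer φ : G → G → ℂ) x y =
        khat Γ (oneMat (Ψ →ᵇ ℂ) - outer (evalMap hΨ)) x y := by
  classical
  by_contra hcon
  obtain ⟨ψ₀, hψ₀⟩ := hne
  have hE1 : ∀ x, ‖evalMap hΨ x‖ ≤ 1 := fun x =>
    (BoundedContinuousFunction.norm_le zero_le_one).2 fun ψ => hΨ.norm_apply_le ψ.1 ψ.2 x
  obtain ⟨Λ, hΛ, hΛT, hΛφ⟩ := exists_separating_weight (evalMap hΨ) hE1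
    (fun e he => hΨ.norm_evalMap_lt he) ⟨ψ₀, hψ₀⟩ hF φ hcon
  apply hΛφ
  -- The perturbed matrix is exactly the condition for the weight `Λ + ε`, whose inverse extends to
  -- a kernel in `kernelFamily Ψ`.
  refine posSemidef_of_forall_add_smul _ (1 - (toeplitz F φ)ᴴ * toeplitz F φ) fun ε hε => ?_
  have hmem := diagExtend_mem_kernelFamily hΨ hF hΛ (fun ψ hψ => hΛT ⟨ψ, hψ⟩) hε
  have h1 := h _ hmem F
  have hε' : (0 : ℂ) < ε := by exact_mod_cast hε
  have hΛε : (Λ + (ε : ℂ) • (1 : Matrix F F ℂ)).PosDef :=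
    Matrix.PosDef.posSemidef_add hΛ (Matrix.PosDef.one.smul hε')
  rw [kconv_eq_toeplitz hF, diagExtend_self, posSemidef_inv_sub_iff hΛε] at h1
  convert h1 using 1
  simp only [Matrix.mul_add, Matrix.add_mul, Matrix.mul_smul, Matrix.smul_mul, Matrix.mul_one,
    smul_sub]
  abel

end Separation

/-! ### The realization theorem -/

theorem theorem1 {G : Type u} [Semigroupoid G] (Ψ : Set (G → ℂ)) (hΨ : IsTestFamily Ψ)
    (hne : Ψ.Nonempty) (φ : G → ℂ) :
    List.TFAE [
      MemHInfty Ψ φ ∧ hInftyNorm Ψ φ ≤ 1,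
      ∀ F : Finset G, IsLower (F : Set G) →
        ∃ Γ : F → F → StrongDual ℂ (Ψ →ᵇ ℂ), IsPosDualKernel Γ ∧
          ∀ x y : F, (oneMat ℂ - outer φ : G → G → ℂ) x y =
            khat (extendKernel Γ) (oneMat (Ψ →ᵇ ℂ) - outer (evalMap hΨ)) x y,
      ∃ Γ : G → G → StrongDual ℂ (Ψ →ᵇ ℂ), IsPosDualKernel Γ ∧
        ∀ x y : G, (oneMat ℂ - outer φ : G → G → ℂ) x y =
          khat Γ (oneMat (Ψ →ᵇ ℂ) - outer (evalMap hΨ)) x y,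
      ∃ S : UnitaryColligation (Ψ →ᵇ ℂ), φ = S.transfer (evalMap hΨ)] := by
  have hE1 : ∀ x, ‖evalMap hΨ x‖ ≤ 1 := fun x =>
    (BoundedContinuousFunction.norm_le zero_le_one).2 fun ψ => hΨ.norm_apply_le ψ.1 ψ.2 x
  have hE : ∀ e, IsIdem e → ‖evalMap hΨ e‖ < 1 := fun e he => hΨ.norm_evalMap_lt he
  tfae_have 1 → 2 := by
    rintro ⟨h, h1⟩ F hF
    obtain ⟨Γ, hΓ, hP⟩ := exists_kernel_on_finite_lower hΨ hne
      (fun k hk => isPosKernel_of_hInftyNorm_le_one h h1 hk) hF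
    -- The product at points of the lower set `F` involves `Γ` only on `F × F`, so restriction
    -- followed by extension by zero leaves it unchanged.
    refine ⟨fun x y => Γ x y, hΓ.restrict (Function.Embedding.subtype _), fun x y => ?_⟩
    rw [hP]
    refine khat_congr hF (fun a ha b hb => ?_) _ x.2 y.2
    exact (extendKernel_apply (fun x y : F => Γ x y) ⟨a, ha⟩ ⟨b, hb⟩).symm
  tfae_have 2 → 3 := exists_global_kernel (evalMap hΨ) hE1 hE _
  tfae_have 3 → 4 := by
    rintro ⟨Γ, hΓ, h⟩
    obtain ⟨ψ₀, hψ₀⟩ := hne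
    exact exists_colligation ⟨ψ₀, hψ₀⟩ (evalMap hΨ) hE φ Γ hΓ h
  tfae_have 4 → 1 := by
    rintro ⟨S, rfl⟩
    have h1 : (1 : ℝ) ∈ hInftyBounds Ψ (S.transfer (evalMap hΨ)) := by
      refine ⟨one_pos, fun k hk => ?_⟩
      have := S.isPosKernel_transfer hΨ k hk
      simpa using this
    exact ⟨⟨1, h1⟩, csInf_le ⟨0, fun C hC => hC.1.le⟩ h1⟩
  tfae_finish
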